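/- Setting. Let $\mathscr M$ be a finite set of positive integers and for each $m\in\mathscr M$ let a residue class $a_m \bmod m$ be given. Let $Q=\operatorname{lcm}(m:m\in\mathscr M)$, $v_p=v_p(Q)$, and let $2\le P_0<P_1<\dots$ be real numbers; throughout, $p$ denotes a prime. Put $Q_j=\prod_{p\le P_j}p^{v_p}$, $\mathscr M_j=\{m\in\mathscr M: m\mid Q_j\}$, $R_j=\{z\in\mathbb Z: z\not\equiv a_m \bmod m \text{ for all } m\in\mathscr M_j\}$ and $$\mathcal N_{j+1}=\{n>1: n\mid Q_{j+1},\ p\mid n\Rightarrow P_j<p\le P_{j+1}\}.$$ For $X\subset\mathbb Z$ write $|X\bmod q|$ for the number of residue classes modulo $q$ that meet $X$. For $r\in R_j$ and $n\in\mathcal N_{j+1}$ let $$A_{n,r}=(r\bmod Q_j)\cap\bigcup_{m_0\mid Q_j,\ m_0n\in\mathscr M_{j+1}}(a_{m_0n}\bmod m_0n).$$ For $\lambda>0$, the fibre above $r \bmod Q_j$ is called $\lambda$-good if for every prime $p\in(P_j,P_{j+1}]$ $$\sum_{n\in\mathcal N_{j+1},\,p\mid n}\frac{|A_{n,r}\bmod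 nQ_j|\,e^{\lambda\omega(n)}}{n}\le 1-e^{-\lambda},$$ where $\omega(n)$ is the number of distinct prime factors of $n$. Let $R_{-1}^*=\mathbb Z$, let $i\ge 0$, and for $0\le j<i$ let $R_j^*\subset R_{j-1}^*\cap R_j$ be any set that is defined modulo $Q_j$. Let $\mu_0$ be the uniform probability measure on $R_0\bmod Q_0$. Given $\mu_j$ and a set $R_j^*\subset R_{j-1}^*\cap R_j$ defined modulo $Q_j$, let $\mu_{j+1}$ be the measure on $R_j^*\cap R_{j+1}\bmod Q_{j+1}$ with $$\mu_{j+1}(r)=\frac{\mu_j(r \bmod Q_j)}{|R_{j+1}\cap(r\bmod Q_j)\bmod Q_{j+1}|}.$$ For $k\ge1$ the $k$-th bias statistic $\beta_k(j)\geq 0$ is given by $$\beta_k^k(j)=\sum_{m\mid Q_j}\ell_k(m)\max_{b\bmod m}\frac{\mu_j(R_{j-1}^*\cap R_j\cap(b\bmod m))}{\mu_j(R_{j-1}^*\cap R_j)},$$ where $\ell_k(m)$ is the number of $k$-tuples of positive integers with least common multiple $m$. Theorem. Let $0<\pi^{\mathrm{good}}<1$ and $\lambda>0$. Suppose that $R_{i-1}^*\cap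 R_i$ is non-empty, and that $$\prod_{P_i<p\le P_{i+1}}\Bigl(1+\frac{e^\lambda}{p-1}\Bigr)\le\frac{1-e^{-\lambda}}{e^\lambda}\,\max_{k\geq 1}\frac{(1-\pi^{\mathrm{good}})^{1/k}}{\beta_k(i)}\Bigl(\sum_{P_i<p\le P_{i+1}}\frac1{(p-1)^k}\Bigr)^{-1/k},\tag{C1}$$ meaning that the inequality holds for the term of at least one integer $k\ge1$; if there is no prime in $(P_i,P_{i+1}]$, the right side is $+\infty$ and (C1) holds. Let $R_i^*$ be the set of all $r\in R_{i-1}^*\cap R_i$ whose fibre is $\lambda$-good. Then $R_i^*$ is defined modulo $Q_i$ and $$\frac{\mu_i(R_i^*)}{\mu_i(R_{i-1}^*\cap R_i)}\ge\pi^{\mathrm{good}};$$ for every $r\in R_i^*$ the density of $R_{i+1}$ in the fibre $(r\bmod Q_i)$ is positive; and the bias statistics $\beta_k(i+1)$ of $R_i^*\cap R_{i+1}$ with respect to $\mu_{i+1}$ satisfy, for every $k\ge1$, $$\beta_k^k(i+1)\le\frac{\beta_k^k(i)}{\pi^{\mathrm{good}}}\prod_{P_i<p\le P_{i+1}}\Bigl(1+e^\lambda\sum_{j=1}^{v_p}\frac{(j+1)^k-j^k}{p^j}\Bigr).$$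 -/

import Mathlib

/-- `|X mod q|`: the number of residue classes modulo `q` that are met by the set `X` of integers. -/
noncomputable def residueCount (q : ℕ) (X : Set ℤ) : ℕ :=
  ((fun z : ℤ => (z : ZMod q)) '' X).ncard

/-- The residue class `b mod q`, as a set of integers. -/
def residueClass (b : ℤ) (q : ℕ) : Set ℤ := {z | z ≡ b [ZMOD q]}

/-- `X` is defined modulo `q`, that is, `X` is a union of residue classes modulo `q`. -/
def DefinedMod (q : ℕ) (X : Set ℤ) : Prop :=
  ∀ x y : ℤ, x ≡ y [ZMOD q] → (x ∈ X ↔ y ∈ X)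

/-- The primes `p` with `a < p ≤ b`. -/
noncomputable def primesIoc (a b : ℝ) : Finset ℕ :=
  {p ∈ Finset.range (⌊b⌋₊ + 1) | p.Prime ∧ a < p ∧ (p : ℝ) ≤ b}

/-- `ℓ_k(m)`: the number of `k`-tuples of natural numbers with least common multiple `m`. -/
noncomputable def lcmTupleCount (k m : ℕ) : ℕ :=
  {f : Fin k → ℕ | Finset.univ.lcm f = m}.ncard

/-- A finite set of positive moduli `m`, each with one residue class `a_m mod m`. -/
structure CongruenceSystem where
  /-- the distinct moduli -/
  moduli : Finset ℕ
  /-- all moduli are positive -/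
  moduli_pos : ∀ m ∈ moduli, 0 < m
  /-- the representative `a_m` of the residue class attached to the modulus `m` -/
  residue : ℕ → ℤ

namespace CongruenceSystem

variable (C : CongruenceSystem) (P : ℕ → ℝ)

/-- `Q`, the least common multiple of all the moduli. -/
def totalModulus : ℕ := C.moduli.lcm id

/-- `Q_i`, the product of `p ^ v_p(Q)` over the primes `p ≤ P_i`. -/
noncomputable def Q (i : ℕ) : ℕ :=
  ∏ p ∈ primesIoc 0 (P i), p ^ padicValNat p C.totalModulus

/-- `𝓜_i`, the set of moduli dividing `Q_i`. -/
noncomputable def stageModuli (i : ℕ) : Finset ℕ := {m ∈ C.moduli | m ∣ C.Q P i}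

/-- `R_i`, the set of integers that avoid `a_m mod m` for every modulus `m` dividing `Q_i`. -/
def R (i : ℕ) : Set ℤ := {z | ∀ m ∈ C.stageModuli P i, z ∉ residueClass (C.residue m) m}

open scoped Classical in
/-- `𝓝_{i+1}`, the divisors `n > 1` of `Q_{i+1}` all of whose prime factors lie in
`(P_i, P_{i+1}]`. -/
noncomputable def newFactors (i : ℕ) : Finset ℕ :=
  {n ∈ (C.Q P (i + 1)).divisors |
    1 < n ∧ ∀ p : ℕ, p.Prime → p ∣ n → P i < p ∧ (p : ℝ) ≤ P (i + 1)}

/-- `A_{n,r}`, for `n` in `𝓝_{i+1}`: the part of the fibre `r mod Q_i` that is removed by the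
congruences to moduli `m₀ n` in `𝓜_{i+1}` with `m₀ ∣ Q_i`. -/
def removed (i n : ℕ) (r : ℤ) : Set ℤ :=
  residueClass r (C.Q P i) ∩
    {z | ∃ m₀ : ℕ, m₀ ∣ C.Q P i ∧ m₀ * n ∈ C.stageModuli P (i + 1) ∧
      z ∈ residueClass (C.residue (m₀ * n)) (m₀ * n)}

/-- The fibre above `r mod Q_i` is `lam`-good. -/
def IsGood (i : ℕ) (lam : ℝ) (r : ℤ) : Prop :=
  ∀ p ∈ primesIoc (P i) (P (i + 1)),
    ∑ n ∈ C.newFactors P i with p ∣ n,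
      (residueCount (n * C.Q P i) (C.removed P i n r) : ℝ)
        * Real.exp (lam * n.primeFactors.card) / n
      ≤ 1 - Real.exp (-lam)

/-- The part `R_{i+1} ∩ (r mod Q_i)` of `R_{i+1}` in the fibre above `r mod Q_i`. -/
def fibrePart (i : ℕ) (r : ℤ) : Set ℤ := C.R P (i + 1) ∩ residueClass r (C.Q P i)

/-- The density of `R_{i+1}` in the fibre `r mod Q_i`, regarded as a subset of `ℤ / Q_{i+1}`. -/
noncomputable def fibreDensity (i : ℕ) (r : ℤ) : ℝ :=
  (residueCount (C.Q P (i + 1)) (C.fibrePart P i r) : ℝ)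
    / residueCount (C.Q P (i + 1)) (residueClass r (C.Q P i))

open scoped Classical in
/-- The point weights of `μ_0`, the uniform probability measure on `R_0 mod Q_0`. Measures on
`ℤ / Q_i` are given by their point weights, as functions of an integer representative. -/
noncomputable def initialWeight (r : ℤ) : ℝ :=
  if r ∈ C.R P 0 then 1 / (residueCount (C.Q P 0) (C.R P 0) : ℝ) else 0

open scoped Classical in
/-- The point weights of `μ_{i+1}`, given those of `μ_i` and the set `T = R_i^*`: for
`r` in `T ∩ R_{i+1}`, the weight `μ_i(r)` is shared equally among the classes modulo `Q_{i+1}`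
in `R_{i+1} ∩ (r mod Q_i)`. -/
noncomputable def nextWeight (i : ℕ) (T : Set ℤ) (w : ℤ → ℝ) (r : ℤ) : ℝ :=
  if r ∈ T ∩ C.R P (i + 1) then
    w r / (residueCount (C.Q P (i + 1)) (C.fibrePart P i r) : ℝ)
  else 0

/-- The point weights of `μ_i`, for a sequence of sets with `S j = R_{j-1}^*`. -/
noncomputable def weight (S : ℕ → Set ℤ) : ℕ → ℤ → ℝ
  | 0 => C.initialWeight P
  | i + 1 => C.nextWeight P i (S (i + 1)) (weight S i)

open scoped Classical in
/-- The mass of a set `X` defined modulo `Q_i`, for the measure on `ℤ / Q_i` with point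
weights `w`. -/
noncomputable def mass (i : ℕ) (w : ℤ → ℝ) (X : Set ℤ) : ℝ :=
  ∑ r ∈ Finset.range (C.Q P i) with ((r : ℤ) ∈ X), w r

/-- `β_k^k(i)`, the `k`-th power of the `k`-th bias statistic of the set `X ⊆ ℤ / Q_i` with respect
to the measure with point weights `w`. -/
noncomputable def biasPow (i : ℕ) (w : ℤ → ℝ) (X : Set ℤ) (k : ℕ) : ℝ :=
  ∑ m ∈ (C.Q P i).divisors, (lcmTupleCount k m : ℝ) *
    ⨆ b : Fin m, C.mass P i w (X ∩ residueClass (b : ℕ) m) / C.mass P i w X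

/-- `β_k(i)`, the `k`-th bias statistic. -/
noncomputable def bias (i : ℕ) (w : ℤ → ℝ) (X : Set ℤ) (k : ℕ) : ℝ :=
  C.biasPow P i w X k ^ (1 / (k : ℝ))

/-- The constraint (C1), for the set `X = R_{i-1}^* ∩ R_i` and the point weights `w` of `μ_i`. A
number is at most a maximum over `k ≥ 1` if it is at most one of the terms. The denominators
`β_k(i)` and `(∑ 1 / (p - 1) ^ k) ^ (1 / k)` are cleared, so that the constraint holds when there
is no prime in `(P_i, P_{i+1}]` (then the right side of the constraint is infinite). -/
def ConstraintC1 (i : ℕ) (w : ℤ → ℝ) (X : Set ℤ) (lam pigood : ℝ) : Prop :=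
  ∃ k : ℕ, 1 ≤ k ∧
    (∏ p ∈ primesIoc (P i) (P (i + 1)), (1 + Real.exp lam / ((p : ℝ) - 1))) *
        (C.bias P i w X k *
          (∑ p ∈ primesIoc (P i) (P (i + 1)), 1 / ((p : ℝ) - 1) ^ k) ^ (1 / (k : ℝ)))
      ≤ (1 - Real.exp (-lam)) / Real.exp lam * (1 - pigood) ^ (1 / (k : ℝ))

end CongruenceSystem

/-! Put N = Q_{i+1}/Q_i, which is prime to Q_i, and write the points of the fibre above r ∈ R_i as r
+ Q_i t with t mod N. In the coordinate t each A_{n,r} becomes a set periodic modulo n, with n ∣ N,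
and R_{i+1} becomes the common complement of these sets. By the Chinese remainder theorem, sets that
involve disjoint sets of primes are independent, so goodness of a fibre is the hypothesis of a
Lovász local lemma whose steps are primes (`countMod_sifted_erase_le`): sifting by one more prime
keeps at least the proportion e^(-λ). Hence a good fibre keeps positive density, and a residue class
modulo n ∣ N fills at most e^(λω(n))/n of what survives in it (`countMod_fibre_residueClass_le`).

Growth of the bias: a divisor of Q_{i+1} is uniquely m n with m ∣ Q_i and n ∣ N. The condition
modulo m is seen at stage i, the condition modulo n costs e^(λω(n))/n, and restricting to good
fibres shrinks the total mass by at most the factor π^good. As ℓ_k is multiplicative, the sum over n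
is the Euler product in the conclusion (`biasPow_next_le`).

Scarcity of bad fibres: |A_{n,r} mod n Q_i| is at most the number of m₀ ∣ Q_i with r ≡ a_{m₀n} mod
m₀. The k-th moment of this number over r expands into k-tuples of moduli. The classes of a tuple
have either no common point or one common class modulo their lcm, so the normalized moment is at
most β_k^k (`moment_classes_le`). Convexity carries this bound to weighted sums over n, and Markov's
inequality at the level 1 - e^(-λ), summed over p, turns (C1) into a bad proportion of at most 1 -
π^good (`mass_bad_le`). -/

/-! ### Counting residues, fibres and independence. -/

open scoped Classical in
/-- The number of residues `0 ≤ t < q` that lie in the set `X` of integers. -/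
noncomputable def countMod (q : ℕ) (X : Set ℤ) : ℕ :=
  Finset.card {t ∈ Finset.range q | ((t : ℕ) : ℤ) ∈ X}

theorem residueClass_eq {r s : ℤ} {q : ℕ} (h : r ≡ s [ZMOD q]) :
    residueClass r q = residueClass s q := by
  ext z
  exact ⟨fun hz => Int.ModEq.trans hz h, fun hz => Int.ModEq.trans hz h.symm⟩

theorem definedMod_residueClass (b : ℤ) (q : ℕ) : DefinedMod q (residueClass b q) :=
  fun _ _ h => ⟨fun hx => h.symm.trans hx, fun hy => h.trans hy⟩

theorem DefinedMod.inter {q : ℕ} {X Y : Set ℤ} (hX : DefinedMod q X) (hY : DefinedMod q Y) :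
    DefinedMod q (X ∩ Y) :=
  fun x y h => and_congr (hX x y h) (hY x y h)

theorem DefinedMod.of_dvd {q q' : ℕ} {X : Set ℤ} (hX : DefinedMod q X) (h : q ∣ q') :
    DefinedMod q' X :=
  fun x y hxy => hX x y (hxy.of_dvd (Int.natCast_dvd_natCast.mpr h))

theorem DefinedMod.preimage_fibre {n M : ℕ} {X : Set ℤ} (hX : DefinedMod (n * M) X) (r : ℤ) :
    DefinedMod n {t | r + M * t ∈ X} := by
  intro x y h
  apply hX
  apply Int.ModEq.add_left
  push_cast
  rw [mul_comm (n : ℤ)]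
  exact h.mul_left'

theorem countMod_mono {q : ℕ} {X Y : Set ℤ} (h : X ⊆ Y) : countMod q X ≤ countMod q Y := by
  classical
  refine Finset.card_le_card fun t ht => ?_
  simp only [Finset.mem_filter] at ht ⊢
  exact ⟨ht.1, h ht.2⟩

theorem countMod_univ (q : ℕ) : countMod q Set.univ = q := by
  simp [countMod]

theorem residueCount_pos {q : ℕ} (hq : 0 < q) {X : Set ℤ} (hX : X.Nonempty) :
    0 < residueCount q X := by
  have : NeZero q := ⟨hq.ne'⟩
  exact (Set.ncard_pos (Set.toFinite _)).mpr (hX.image _)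

/-- A subset of the fibre `r mod M`, parametrized by `t ↦ r + M t`. -/
theorem residueCount_fibre {n M : ℕ} (hn : 0 < n) (hM : 0 < M) (r : ℤ) {X : Set ℤ}
    (hX : DefinedMod (n * M) X) (hr : X ⊆ residueClass r M) :
    residueCount (n * M) X = countMod n {t | r + M * t ∈ X} := by
  classical
  have himg : (fun z : ℤ => (z : ZMod (n * M))) '' X =
      ((Finset.range n).filter (fun t : ℕ => r + M * (t : ℤ) ∈ X)).image
        (fun t : ℕ => ((r + M * (t : ℤ) : ℤ) : ZMod (n * M))) := by
    ext y
    simp only [Set.mem_image, Finset.coe_image, Finset.coe_filter, Set.mem_ofPred_eq,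
      Finset.mem_range]
    constructor
    · rintro ⟨z, hz, rfl⟩
      obtain ⟨s, hs⟩ := (Int.modEq_iff_dvd.mp (hr hz).symm)
      have hn' : (0 : ℤ) < n := by exact_mod_cast hn
      have hlt := Int.emod_lt_of_pos s hn'
      have hnn := Int.emod_nonneg s hn'.ne'
      obtain ⟨t, ht⟩ := Int.eq_ofNat_of_zero_le hnn
      have hmod : r + M * (t : ℤ) ≡ z [ZMOD ((n * M : ℕ) : ℤ)] := by
        have h1 : z = r + M * s := by linarith
        rw [h1]
        apply Int.ModEq.add_left
        push_cast
        rw [mul_comm (n : ℤ)]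
        refine Int.ModEq.mul_left' ?_
        have h2 := Int.mod_modEq s n
        rwa [ht] at h2
      refine ⟨t, ⟨by omega, (hX _ _ hmod).mpr hz⟩, ?_⟩
      exact (ZMod.intCast_eq_intCast_iff _ _ _).mpr hmod
    · rintro ⟨t, ⟨-, ht⟩, rfl⟩
      exact ⟨_, ht, rfl⟩
  rw [residueCount, himg, Set.ncard_coe_finset, Finset.card_image_of_injOn]
  · rfl
  · intro s hs t ht hst
    simp only [Finset.coe_filter, Finset.mem_range, Set.mem_ofPred_eq] at hs ht
    have h := (ZMod.intCast_eq_intCast_iff _ _ _).mp hst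
    have h2 := h.add_left_cancel'
    push_cast at h2
    rw [mul_comm (n : ℤ)] at h2
    have h3 := Int.ModEq.mul_left_cancel' (by exact_mod_cast hM.ne') h2
    have h4 := (Int.natCast_modEq_iff.mp h3)
    rwa [Nat.ModEq, Nat.mod_eq_of_lt hs.1, Nat.mod_eq_of_lt ht.1] at h4

theorem sum_range_mul {α : Type*} [AddCommMonoid α] (M N : ℕ) (f : ℕ → α) :
    ∑ z ∈ Finset.range (M * N), f z =
      ∑ r ∈ Finset.range M, ∑ t ∈ Finset.range N, f (r + M * t) := by
  rw [Finset.sum_comm]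
  induction N with
  | zero => simp
  | succ N ih =>
    rw [Finset.sum_range_succ, ← ih, Nat.mul_succ, Finset.sum_range_add]
    simp [add_comm]

theorem countMod_eq_card (q : ℕ) (X : Set ℤ) [DecidablePred (· ∈ X)] :
    countMod q X = Finset.card {t ∈ Finset.range q | ((t : ℕ) : ℤ) ∈ X} := by
  unfold countMod
  congr!

theorem countMod_eq_sum (q : ℕ) (X : Set ℤ) [DecidablePred (· ∈ X)] :
    countMod q X = ∑ t ∈ Finset.range q, if ((t : ℕ) : ℤ) ∈ X then 1 else 0 := by
  rw [countMod, Finset.card_filter]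
  congr! 2

theorem countMod_mul_right {n : ℕ} {X : Set ℤ} (hX : DefinedMod n X) (c : ℕ) :
    countMod (n * c) X = countMod n X * c := by
  classical
  rw [countMod_eq_sum, countMod_eq_sum, sum_range_mul, Finset.sum_mul]
  refine Finset.sum_congr rfl fun r _ => ?_
  have : ∀ t : ℕ, ((r + n * t : ℕ) : ℤ) ∈ X ↔ (r : ℤ) ∈ X := by
    intro t
    apply hX
    simp [Int.ModEq]
  simp_rw [this]
  simp [mul_comm]

theorem countMod_inter_of_coprime {a b : ℕ} (ha : 0 < a) (hb : 0 < b) (hab : a.Coprime b)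
    {X Y : Set ℤ} (hX : DefinedMod a X) (hY : DefinedMod b Y) :
    countMod (a * b) (X ∩ Y) = countMod a X * countMod b Y := by
  classical
  unfold countMod
  rw [← Finset.card_product]
  have key : ∀ (q z : ℕ) (Z : Set ℤ), DefinedMod q Z → (((z % q : ℕ) : ℤ) ∈ Z ↔ (z : ℤ) ∈ Z) := by
    intro q z Z hZ
    apply hZ
    exact_mod_cast Nat.mod_modEq z q
  refine Finset.card_nbij' (fun z => (z % a, z % b)) (fun p => Nat.chineseRemainder hab p.1 p.2)
    ?_ ?_ ?_ ?_
  · intro z hz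
    simp only [Finset.coe_filter, Finset.mem_range, Set.mem_ofPred_eq, Set.mem_inter_iff] at hz
    simp only [Finset.coe_product, Finset.coe_filter, Finset.mem_range, Set.mem_prod,
      Set.mem_ofPred_eq]
    exact ⟨⟨Nat.mod_lt _ ha, (key _ _ _ hX).mpr hz.2.1⟩, Nat.mod_lt _ hb, (key _ _ _ hY).mpr hz.2.2⟩
  · rintro ⟨s, t⟩ h
    simp only [Finset.coe_product, Finset.coe_filter, Finset.mem_range, Set.mem_prod,
      Set.mem_ofPred_eq] at h
    simp only [Finset.coe_filter, Finset.mem_range, Set.mem_ofPred_eq, Set.mem_inter_iff]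
    have h1 := (Nat.chineseRemainder hab s t).2
    exact ⟨Nat.chineseRemainder_lt_mul hab s t ha.ne' hb.ne',
      (hX _ _ (by exact_mod_cast h1.1)).mpr h.1.2, (hY _ _ (by exact_mod_cast h1.2)).mpr h.2.2⟩
  · intro z hz
    simp only [Finset.coe_filter, Finset.mem_range, Set.mem_ofPred_eq] at hz
    have h1 := (Nat.chineseRemainder hab (z % a) (z % b)).2
    have h2 := (Nat.modEq_and_modEq_iff_modEq_mul hab).mp
      ⟨h1.1.trans (Nat.mod_modEq z a), h1.2.trans (Nat.mod_modEq z b)⟩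
    exact Nat.ModEq.eq_of_lt_of_lt h2
      (Nat.chineseRemainder_lt_mul hab _ _ ha.ne' hb.ne') hz.1
  · rintro ⟨s, t⟩ h
    simp only [Finset.coe_product, Finset.coe_filter, Finset.mem_range, Set.mem_prod,
      Set.mem_ofPred_eq] at h
    have h1 := (Nat.chineseRemainder hab s t).2
    ext
    · exact Eq.trans h1.1 (Nat.mod_eq_of_lt h.1.1)
    · exact Eq.trans h1.2 (Nat.mod_eq_of_lt h.2.1)

/-- Independence with denominators cleared: division by a N gives the product of the two densities.
The second count is taken modulo N, so that `b`, in use the lcm of many moduli, drops out of the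
formula. -/
theorem countMod_inter_mul {a b N : ℕ} (hN : 0 < N) (haN : a ∣ N) (hbN : b ∣ N)
    (hab : a.Coprime b) {X Y : Set ℤ} (hX : DefinedMod a X) (hY : DefinedMod b Y) :
    a * countMod N (X ∩ Y) = countMod a X * countMod N Y := by
  have ha := Nat.pos_of_dvd_of_pos haN hN
  have hb := Nat.pos_of_dvd_of_pos hbN hN
  obtain ⟨c, rfl⟩ := hab.mul_dvd_of_dvd_of_dvd haN hbN
  have h1 : DefinedMod (a * b) (X ∩ Y) :=
    (hX.of_dvd (dvd_mul_right a b)).inter (hY.of_dvd (dvd_mul_left b a))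
  rw [countMod_mul_right h1, countMod_inter_of_coprime ha hb hab hX hY,
    show a * b * c = b * (a * c) by ring, countMod_mul_right hY]
  ring

/-- At most one residue `t` modulo `n` solves `r + M t ≡ b [ZMOD n]` when `M` is prime to `n`. -/
theorem countMod_linear_le_one {n M : ℕ} (h : n.Coprime M) (r b : ℤ) :
    countMod n {t | r + M * t ≡ b [ZMOD n]} ≤ 1 := by
  classical
  refine Finset.card_le_one.mpr fun s hs t ht => ?_
  simp only [Finset.mem_filter, Finset.mem_range, Set.mem_ofPred_eq] at hs ht
  have h1 : (M : ℤ) * s ≡ M * t [ZMOD n] := (hs.2.trans ht.2.symm).add_left_cancel'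
  have h2 : (s : ℤ) ≡ t [ZMOD n] := by
    exact_mod_cast Nat.ModEq.cancel_left_of_coprime h (by exact_mod_cast h1)
  exact Nat.ModEq.eq_of_lt_of_lt (Int.natCast_modEq_iff.mp h2) hs.1 ht.1

/-! ### The local lemma. -/

/-- The set of integers that avoid all `A n`, `n ∈ 𝒩`, with `n` supported on the primes in `s`. -/
def sifted (𝒩 : Finset ℕ) (A : ℕ → Set ℤ) (s : Finset ℕ) : Set ℤ :=
  {z | ∀ n ∈ 𝒩, n.primeFactors ⊆ s → z ∉ A n}

theorem sifted_anti (𝒩 : Finset ℕ) (A : ℕ → Set ℤ) {s t : Finset ℕ} (h : s ⊆ t) :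
    sifted 𝒩 A t ⊆ sifted 𝒩 A s :=
  fun _ hz n hn hs => hz n hn (hs.trans h)

/-- The lcm runs only over the `n` supported on `s`, so it is prime to every integer without prime
factors in `s`. This is the source of independence. -/
theorem definedMod_sifted {𝒩 : Finset ℕ} {A : ℕ → Set ℤ} (hA : ∀ n ∈ 𝒩, DefinedMod n (A n))
    (s : Finset ℕ) :
    DefinedMod (({n ∈ 𝒩 | n.primeFactors ⊆ s} : Finset ℕ).lcm id) (sifted 𝒩 A s) := by
  intro x y hxy
  refine forall_congr' fun n => forall_congr' fun hn => forall_congr' fun hs => not_congr ?_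
  exact ((hA n hn).of_dvd
    (Finset.dvd_lcm (f := id) (Finset.mem_filter.mpr ⟨hn, hs⟩))) x y hxy

/-- Independence of a set defined modulo `n` and a sifted set over primes not dividing `n`. -/
theorem countMod_inter_sifted {N : ℕ} (hN : 0 < N) {𝒩 : Finset ℕ} (h𝒩 : ∀ n ∈ 𝒩, n ∣ N)
    {A : ℕ → Set ℤ} (hA : ∀ n ∈ 𝒩, DefinedMod n (A n)) {s : Finset ℕ} {n : ℕ} (hn : n ∣ N)
    (hs : Disjoint n.primeFactors s) {X : Set ℤ} (hX : DefinedMod n X) :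
    n * countMod N (X ∩ sifted 𝒩 A s) = countMod n X * countMod N (sifted 𝒩 A s) := by
  refine countMod_inter_mul hN hn ?_ ?_ hX (definedMod_sifted hA s)
  · exact Finset.lcm_dvd fun m hm => h𝒩 m (Finset.mem_filter.mp hm).1
  · refine Nat.Coprime.of_dvd_right (Finset.lcm_dvd_prod _ id) ?_
    refine Nat.Coprime.prod_right fun m hm => ?_
    obtain ⟨hm, hms⟩ := Finset.mem_filter.mp hm
    have hn0 : n ≠ 0 := (Nat.pos_of_dvd_of_pos hn hN).ne'
    have hm0 : m ≠ 0 := (Nat.pos_of_dvd_of_pos (h𝒩 m hm) hN).ne'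
    exact (Nat.disjoint_primeFactors hn0 hm0).mp (hs.mono_right hms)

/-- Union bound: a point lost on adding `p` lies in some `A n` with `p ∣ n`. Of its other properties
only the sifting by primes outside `n` is kept, since that part is independent of `A n`. -/
theorem countMod_sifted_le {N : ℕ} {𝒩 : Finset ℕ} {A : ℕ → Set ℤ} {s : Finset ℕ} {p : ℕ} :
    countMod N (sifted 𝒩 A (s.erase p)) ≤ countMod N (sifted 𝒩 A s) +
      ∑ n ∈ 𝒩 with (p ∣ n ∧ n.primeFactors ⊆ s),
        countMod N (A n ∩ sifted 𝒩 A (s \ n.primeFactors)) := by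
  classical
  suffices hsub : {t ∈ Finset.range N | ((t : ℕ) : ℤ) ∈ sifted 𝒩 A (s.erase p)} ⊆
      {t ∈ Finset.range N | ((t : ℕ) : ℤ) ∈ sifted 𝒩 A s} ∪
      ({n ∈ 𝒩 | p ∣ n ∧ n.primeFactors ⊆ s} : Finset ℕ).biUnion fun n =>
        {t ∈ Finset.range N | ((t : ℕ) : ℤ) ∈ A n ∩ sifted 𝒩 A (s \ n.primeFactors)} by
    simp only [countMod_eq_card]
    exact (Finset.card_le_card hsub).trans ((Finset.card_union_le _ _).trans
      (Nat.add_le_add_left Finset.card_biUnion_le _))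
  intro z hz
  simp only [Finset.mem_filter, Finset.mem_range, Finset.mem_union, Finset.mem_biUnion] at hz ⊢
  by_cases hzs : (z : ℤ) ∈ sifted 𝒩 A s
  · exact Or.inl ⟨hz.1, hzs⟩
  · right
    simp only [sifted, Set.mem_ofPred_eq, not_forall, not_not] at hzs
    obtain ⟨n, hn, hns, hzn⟩ := hzs
    have hpn : p ∈ n.primeFactors := by
      by_contra hpn
      exact hz.2 n hn (fun q hq => Finset.mem_erase.mpr ⟨fun h => hpn (h ▸ hq), hns hq⟩) hzn
    refine ⟨n, ⟨hn, Nat.dvd_of_mem_primeFactors hpn, hns⟩, hz.1, hzn, ?_⟩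
    refine sifted_anti 𝒩 A ?_ hz.2
    intro q hq
    rw [Finset.mem_sdiff] at hq
    exact Finset.mem_erase.mpr ⟨fun h => hq.2 (h ▸ hpn), hq.1⟩

/-- If removing one prime costs at most a factor `e^lam`, removing a set of primes `u` costs at
most `e^(lam #u)`. -/
theorem countMod_sifted_sdiff_le {N : ℕ} {𝒩 : Finset ℕ} {A : ℕ → Set ℤ} {lam : ℝ}
    (s : Finset ℕ)
    (h : ∀ t ⊆ s, ∀ p ∈ t, (countMod N (sifted 𝒩 A (t.erase p)) : ℝ) ≤
      Real.exp lam * countMod N (sifted 𝒩 A t)) (u : Finset ℕ) (hu : u ⊆ s) :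
    (countMod N (sifted 𝒩 A (s \ u)) : ℝ) ≤
      Real.exp (lam * u.card) * countMod N (sifted 𝒩 A s) := by
  induction u using Finset.induction_on with
  | empty => simp
  | insert p u hp ih =>
    obtain ⟨hps, hus⟩ := Finset.insert_subset_iff.mp hu
    have h1 := h (s \ u) Finset.sdiff_subset p (Finset.mem_sdiff.mpr ⟨hps, hp⟩)
    rw [← Finset.sdiff_insert] at h1
    refine h1.trans ?_
    rw [Finset.card_insert_of_notMem hp]
    push_cast
    rw [mul_add, mul_one, Real.exp_add]
    calc _ ≤ Real.exp lam * (Real.exp (lam * u.card) * countMod N (sifted 𝒩 A s)) := by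
          gcongr
          exact ih hus
      _ = _ := by ring

/-- The Lovász local lemma for events defined modulo divisors `n` of `N`: sifting by one more prime
keeps at least a proportion `e^(-lam)`. -/
theorem countMod_sifted_erase_le {N : ℕ} (hN : 0 < N) {𝒩 : Finset ℕ} (h𝒩 : ∀ n ∈ 𝒩, n ∣ N)
    {A : ℕ → Set ℤ} (hA : ∀ n ∈ 𝒩, DefinedMod n (A n)) {lam : ℝ} (hlam : 0 < lam)
    (s : Finset ℕ) (hs : ∀ p ∈ s, p.Prime)
    (hgood : ∀ p ∈ s, ∑ n ∈ 𝒩 with p ∣ n,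
      (countMod n (A n) : ℝ) * Real.exp (lam * n.primeFactors.card) / n ≤ 1 - Real.exp (-lam)) :
    ∀ p ∈ s, (countMod N (sifted 𝒩 A (s.erase p)) : ℝ) ≤
      Real.exp lam * countMod N (sifted 𝒩 A s) := by
  induction s using Finset.strongInduction with
  | H s ih =>
    intro p hp
    -- All subsets are needed, not only `s.erase p`: the primes of `n` other than `p` are put back
    -- one at a time.
    have ih' : ∀ t ⊆ s.erase p, ∀ q ∈ t, (countMod N (sifted 𝒩 A (t.erase q)) : ℝ) ≤
        Real.exp lam * countMod N (sifted 𝒩 A t) := by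
      intro t ht
      have hts : t ⊆ s := ht.trans (Finset.erase_subset _ _)
      refine ih t ?_ (fun q hq => hs q (hts hq)) (fun q hq => hgood q (hts hq))
      exact (ht.trans_ssubset (Finset.erase_ssubset hp))
    set c : ℝ := (countMod N (sifted 𝒩 A (s.erase p)) : ℝ)
    have hc0 : 0 ≤ c := Nat.cast_nonneg _
    -- The set s \ primeFactors(n) arises from `s.erase p` by removing only ω(n) - 1 primes, because
    -- `p` is already gone. This gives the extra factor e^(-lam).
    have hbound : ∀ n ∈ ({n ∈ 𝒩 | p ∣ n ∧ n.primeFactors ⊆ s} : Finset ℕ),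
        (countMod N (A n ∩ sifted 𝒩 A (s \ n.primeFactors)) : ℝ) ≤
          (countMod n (A n) : ℝ) * Real.exp (lam * n.primeFactors.card) / n *
            (Real.exp (-lam) * c) := by
      intro n hn
      obtain ⟨hn, hpn, hns⟩ := Finset.mem_filter.mp hn
      have hn0 : 0 < n := Nat.pos_of_dvd_of_pos (h𝒩 n hn) hN
      have hpf : p ∈ n.primeFactors := Nat.mem_primeFactors.mpr ⟨hs p hp, hpn, hn0.ne'⟩
      have h1 := countMod_inter_sifted hN h𝒩 hA (h𝒩 n hn)
        (s := s \ n.primeFactors) Finset.disjoint_sdiff (hA n hn)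
      have h2 := countMod_sifted_sdiff_le (s.erase p) ih' (n.primeFactors.erase p)
        (Finset.erase_subset_erase p hns)
      have h3 : s.erase p \ n.primeFactors.erase p = s \ n.primeFactors := by
        ext q
        by_cases hq : q = p
        · subst hq; simp [hpf]
        · simp [hq]
      rw [h3, Finset.card_erase_of_mem hpf, Nat.cast_sub (Finset.card_pos.mpr ⟨p, hpf⟩),
        Nat.cast_one, mul_sub, mul_one, sub_eq_add_neg, Real.exp_add] at h2
      have hn0' : (0 : ℝ) < n := by exact_mod_cast hn0
      have h1' : (n : ℝ) * countMod N (A n ∩ sifted 𝒩 A (s \ n.primeFactors)) =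
        countMod n (A n) * countMod N (sifted 𝒩 A (s \ n.primeFactors)) := by exact_mod_cast h1
      rw [show (countMod n (A n) : ℝ) * Real.exp (lam * n.primeFactors.card) / n *
            (Real.exp (-lam) * c) = (countMod n (A n) : ℝ) *
              (Real.exp (lam * n.primeFactors.card) * Real.exp (-lam) * c) / n by ring,
        le_div_iff₀ hn0', mul_comm, h1']
      gcongr
    have hsum : (∑ n ∈ 𝒩 with (p ∣ n ∧ n.primeFactors ⊆ s),
        (countMod N (A n ∩ sifted 𝒩 A (s \ n.primeFactors)) : ℝ)) ≤
        (1 - Real.exp (-lam)) * (Real.exp (-lam) * c) := by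
      refine (Finset.sum_le_sum hbound).trans ?_
      rw [← Finset.sum_mul]
      refine mul_le_mul_of_nonneg_right (le_trans ?_ (hgood p hp)) (by positivity)
      refine Finset.sum_le_sum_of_subset_of_nonneg (fun n hn => ?_) (fun _ _ _ => by positivity)
      obtain ⟨h1, h2, -⟩ := Finset.mem_filter.mp hn
      exact Finset.mem_filter.mpr ⟨h1, h2⟩
    have hle : c ≤ countMod N (sifted 𝒩 A s) + ∑ n ∈ 𝒩 with (p ∣ n ∧ n.primeFactors ⊆ s),
        (countMod N (A n ∩ sifted 𝒩 A (s \ n.primeFactors)) : ℝ) := by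
      have := countMod_sifted_le (N := N) (𝒩 := 𝒩) (A := A) (s := s) (p := p)
      simp only [c]
      exact_mod_cast this
    have he : Real.exp lam * Real.exp (-lam) = 1 := by rw [← Real.exp_add]; simp
    have he1 : Real.exp (-lam) ≤ 1 := Real.exp_le_one_iff.mpr (by linarith)
    have he0 := Real.exp_pos (-lam)
    -- With e = e^(-lam), the union bound gives count ≥ c(1 - e(1 - e)), and 1 - e(1 - e) - e = (1 -
    -- e)² ≥ 0.
    have hfin : Real.exp (-lam) * c ≤ countMod N (sifted 𝒩 A s) := by
      have : 0 ≤ (1 - Real.exp (-lam)) * (1 - Real.exp (-lam)) * c :=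
        mul_nonneg (mul_self_nonneg _) hc0
      nlinarith
    calc c = Real.exp lam * (Real.exp (-lam) * c) := by rw [← mul_assoc, he, one_mul]
      _ ≤ _ := by gcongr

section
variable {N : ℕ} {𝒩 : Finset ℕ} {A : ℕ → Set ℤ} {lam : ℝ} {s : Finset ℕ}

theorem countMod_sifted_pos (hN : 0 < N) (h𝒩 : ∀ n ∈ 𝒩, n ∣ N ∧ 1 < n)
    (hA : ∀ n ∈ 𝒩, DefinedMod n (A n)) (hlam : 0 < lam) (hs : ∀ p ∈ s, p.Prime)
    (hgood : ∀ p ∈ s, ∑ n ∈ 𝒩 with p ∣ n,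
      (countMod n (A n) : ℝ) * Real.exp (lam * n.primeFactors.card) / n ≤ 1 - Real.exp (-lam)) :
    0 < countMod N (sifted 𝒩 A s) := by
  have h := countMod_sifted_sdiff_le (N := N) (𝒩 := 𝒩) (A := A) (lam := lam) s
    (fun t ht => countMod_sifted_erase_le hN (fun n hn => (h𝒩 n hn).1) hA hlam t
      (fun q hq => hs q (ht hq)) (fun q hq => hgood q (ht hq))) s subset_rfl
  -- Here `1 < n` is essential: an event with n = 1 would have no primes and would survive the
  -- removal of all of them.
  have h0 : sifted 𝒩 A (s \ s) = Set.univ := by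
    refine Set.eq_univ_of_forall fun z n hn hns => ?_
    have h1 := (h𝒩 n hn).2
    rw [sdiff_self, Finset.bot_eq_empty, Finset.subset_empty, Nat.primeFactors_eq_empty] at hns
    omega
  rw [h0, countMod_univ] at h
  have hN' : (0 : ℝ) < N := by exact_mod_cast hN
  have := pos_of_mul_pos_right (hN'.trans_le h) (Real.exp_pos _).le
  exact_mod_cast this

/-- In a good fibre, a set defined modulo `n` has relative density in the sifted set at most
`e^(lam ω(n))` times its density. -/
theorem countMod_inter_sifted_le (hN : 0 < N) (h𝒩 : ∀ n ∈ 𝒩, n ∣ N)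
    (hA : ∀ n ∈ 𝒩, DefinedMod n (A n)) (hlam : 0 < lam) (hs : ∀ p ∈ s, p.Prime)
    (hgood : ∀ p ∈ s, ∑ n ∈ 𝒩 with p ∣ n,
      (countMod n (A n) : ℝ) * Real.exp (lam * n.primeFactors.card) / n ≤ 1 - Real.exp (-lam))
    {n : ℕ} (hn : n ∣ N) (hns : n.primeFactors ⊆ s) {X : Set ℤ} (hX : DefinedMod n X) :
    (countMod N (X ∩ sifted 𝒩 A s) : ℝ) ≤ countMod n X *
      (Real.exp (lam * n.primeFactors.card) / n) * countMod N (sifted 𝒩 A s) := by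
  have h := countMod_sifted_sdiff_le (N := N) (𝒩 := 𝒩) (A := A) (lam := lam) s
    (fun t ht => countMod_sifted_erase_le hN h𝒩 hA hlam t
      (fun q hq => hs q (ht hq)) (fun q hq => hgood q (ht hq))) n.primeFactors hns
  have h1 := countMod_inter_sifted hN h𝒩 hA hn
    (s := s \ n.primeFactors) Finset.disjoint_sdiff hX
  have h1' : (n : ℝ) * countMod N (X ∩ sifted 𝒩 A (s \ n.primeFactors)) =
    countMod n X * countMod N (sifted 𝒩 A (s \ n.primeFactors)) := by exact_mod_cast h1
  have hn0' : (0 : ℝ) < n := by exact_mod_cast Nat.pos_of_dvd_of_pos hn hN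
  -- Forgetting the primes of `n` enlarges the sifted set and makes it independent of `X`; restoring
  -- them costs the factor in `h`.
  have h2 : (countMod N (X ∩ sifted 𝒩 A s) : ℝ) ≤
      countMod N (X ∩ sifted 𝒩 A (s \ n.primeFactors)) := by
    exact_mod_cast countMod_mono (Set.inter_subset_inter_right _
      (sifted_anti 𝒩 A Finset.sdiff_subset))
  refine h2.trans ?_
  rw [show (countMod n X : ℝ) * (Real.exp (lam * n.primeFactors.card) / n) *
      countMod N (sifted 𝒩 A s) = countMod n X * (Real.exp (lam * n.primeFactors.card) *
      countMod N (sifted 𝒩 A s)) / n by ring, le_div_iff₀ hn0', mul_comm, h1']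
  gcongr

end

/-! ### Tuples with given least common multiple. -/

section
open ArithmeticFunction ArithmeticFunction.zeta ArithmeticFunction.sigma ArithmeticFunction.Moebius

theorem lcmTupleCount_eq (k : ℕ) {m M : ℕ} (hM : 0 < M) (hm : m ∣ M) :
    lcmTupleCount k m = Finset.card
      {f ∈ Fintype.piFinset (fun _ : Fin k => M.divisors) | Finset.univ.lcm f = m} := by
  rw [lcmTupleCount, ← Set.ncard_coe_finset]
  congr 1
  ext f
  simp only [Set.mem_ofPred_eq, Finset.coe_filter, Fintype.mem_piFinset, Nat.mem_divisors]
  refine ⟨fun h => ⟨fun i => ⟨?_, hM.ne'⟩, h⟩, fun h => h.2⟩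
  rw [← h] at hm
  exact (Finset.dvd_lcm (Finset.mem_univ i)).trans hm

/-- Grouping `k`-tuples of divisors of `M` by their least common multiple. -/
theorem sum_piFinset_divisors_lcm (k : ℕ) {M : ℕ} (hM : 0 < M) (g : ℕ → ℝ) :
    ∑ f ∈ Fintype.piFinset (fun _ : Fin k => M.divisors), g (Finset.univ.lcm f) =
      ∑ m ∈ M.divisors, (lcmTupleCount k m : ℝ) * g m := by
  rw [← Finset.sum_fiberwise_of_maps_to (s := Fintype.piFinset (fun _ : Fin k => M.divisors))
    (t := M.divisors) (g := fun f => Finset.univ.lcm f)]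
  · refine Finset.sum_congr rfl fun m hm => ?_
    rw [lcmTupleCount_eq k hM (Nat.dvd_of_mem_divisors hm), ← nsmul_eq_mul, ← Finset.sum_const]
    exact Finset.sum_congr rfl fun f hf => by rw [(Finset.mem_filter.mp hf).2]
  · intro f hf
    rw [Fintype.mem_piFinset] at hf
    exact Nat.mem_divisors.mpr
      ⟨Finset.lcm_dvd fun i _ => Nat.dvd_of_mem_divisors (hf i), hM.ne'⟩

/-- A tuple consists of divisors of `M` exactly when its lcm divides `M`. -/
theorem sum_divisors_lcmTupleCount (k : ℕ) {M : ℕ} (hM : 0 < M) :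
    ∑ m ∈ M.divisors, (lcmTupleCount k m : ℝ) = (M.divisors.card : ℝ) ^ k := by
  have h := sum_piFinset_divisors_lcm k hM fun _ => 1
  simp only [mul_one, Finset.sum_const, Fintype.card_piFinset_const] at h
  rw [← h]
  simp

/-- The partial sums over exponents l ≤ i count the k-tuples of divisors of p^i, of which there are
(i + 1)^k; the value is a difference of two consecutive sums. -/
theorem lcmTupleCount_prime_pow (k : ℕ) {p : ℕ} (hp : p.Prime) {j : ℕ} (hj : 1 ≤ j) :
    (lcmTupleCount k (p ^ j) : ℝ) = ((j : ℝ) + 1) ^ k - (j : ℝ) ^ k := by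
  have key : ∀ i : ℕ, ∑ l ∈ Finset.range (i + 1), (lcmTupleCount k (p ^ l) : ℝ) =
      ((i : ℝ) + 1) ^ k := by
    intro i
    have h := sum_divisors_lcmTupleCount k (pow_pos hp.pos i)
    rw [Nat.divisors_prime_pow hp, Finset.sum_map, Finset.card_map, Finset.card_range] at h
    simpa using h
  obtain ⟨i, rfl⟩ := Nat.exists_eq_succ_of_ne_zero (by omega : j ≠ 0)
  have h1 := key i
  have h2 := key (i + 1)
  rw [Finset.sum_range_succ, h1] at h2
  push_cast at h2 ⊢
  linarith

/-- `lcmTupleCount k` as an arithmetic function. -/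
noncomputable def lcmTupleArith (k : ℕ) : ArithmeticFunction ℝ :=
  -- The value at 0 has to be forced, since `lcmTupleCount 1 0` is 1.
  ⟨fun m => if m = 0 then 0 else lcmTupleCount k m, by simp⟩

/-- Möbius inversion: the divisor sum of ℓ_k is the k-th power of the number of divisors, so ℓ_k is
a convolution of multiplicative functions. -/
theorem isMultiplicative_lcmTupleArith {k : ℕ} (hk : 1 ≤ k) :
    (lcmTupleArith k).IsMultiplicative := by
  have h : lcmTupleArith k * (ζ : ArithmeticFunction ℝ) =
      ((σ 0 : ArithmeticFunction ℕ) : ArithmeticFunction ℝ).ppow k := by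
    ext M
    rcases Nat.eq_zero_or_pos M with rfl | hM
    · simp
    rw [coe_mul_zeta_apply, ppow_apply hk, natCoe_apply, sigma_zero_apply,
      ← sum_divisors_lcmTupleCount k hM]
    refine Finset.sum_congr rfl fun m hm => ?_
    exact if_neg (Nat.pos_of_mem_divisors hm).ne'
  have h2 : lcmTupleArith k = ((σ 0 : ArithmeticFunction ℕ) : ArithmeticFunction ℝ).ppow k *
      (μ : ArithmeticFunction ℝ) := by
    rw [← h, mul_assoc, coe_zeta_mul_coe_moebius, mul_one]
  rw [h2]
  exact (isMultiplicative_sigma.natCast.ppow).mul isMultiplicative_moebius.intCast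

theorem lcmTupleCount_mul {k : ℕ} (hk : 1 ≤ k) {m n : ℕ} (hm : 0 < m) (hn : 0 < n)
    (h : m.Coprime n) :
    (lcmTupleCount k (m * n) : ℝ) = lcmTupleCount k m * lcmTupleCount k n := by
  have := (isMultiplicative_lcmTupleArith hk).map_mul_of_coprime h
  simpa [lcmTupleArith, hm.ne', hn.ne'] using this

theorem lcmTupleCount_one {k : ℕ} (hk : 1 ≤ k) : (lcmTupleCount k 1 : ℝ) = 1 := by
  simpa [lcmTupleArith] using (isMultiplicative_lcmTupleArith hk).map_one

end

/-! ### Euler products and the weight e^(λω(n))/n. -/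

theorem sum_divisors_mul_of_coprime {m n : ℕ} (h : m.Coprime n) (g : ℕ → ℝ) :
    ∑ d ∈ (m * n).divisors, g d = ∑ a ∈ m.divisors, ∑ b ∈ n.divisors, g (a * b) := by
  rw [Nat.divisors_mul, Finset.mul_def, Finset.sum_image h.mul_injOn_divisors,
    Finset.sum_product]

/-- The Euler product of the divisor sum of a multiplicative function. -/
theorem sum_divisors_prod_prime_pow {s : Finset ℕ} (hs : ∀ p ∈ s, p.Prime) (v : ℕ → ℕ)
    {g : ℕ → ℝ} (h1 : g 1 = 1)
    (hmul : ∀ m n : ℕ, 0 < m → 0 < n → m.Coprime n → g (m * n) = g m * g n) :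
    ∑ d ∈ (∏ p ∈ s, p ^ v p).divisors, g d =
      ∏ p ∈ s, (1 + ∑ j ∈ Finset.Icc 1 (v p), g (p ^ j)) := by
  induction s using Finset.induction_on with
  | empty => simp [h1]
  | insert p s hp ih =>
    have hps : p.Prime := hs p (Finset.mem_insert_self _ _)
    have hs' : ∀ q ∈ s, q.Prime := fun q hq => hs q (Finset.mem_insert_of_mem hq)
    have hcop : (p ^ v p).Coprime (∏ q ∈ s, q ^ v q) :=
      Nat.Coprime.prod_right fun q hq => Nat.Coprime.pow _ _
        ((Nat.coprime_primes hps (hs' q hq)).mpr fun h => hp (h ▸ hq))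
    rw [Finset.prod_insert hp, Finset.prod_insert hp, sum_divisors_mul_of_coprime hcop, ← ih hs']
    have : ∀ a ∈ (p ^ v p).divisors, ∑ b ∈ (∏ q ∈ s, q ^ v q).divisors, g (a * b) =
        g a * ∑ b ∈ (∏ q ∈ s, q ^ v q).divisors, g b := by
      intro a ha
      rw [Finset.mul_sum]
      refine Finset.sum_congr rfl fun b hb => hmul a b (Nat.pos_of_mem_divisors ha)
        (Nat.pos_of_mem_divisors hb) ?_
      exact (hcop.of_dvd_left (Nat.dvd_of_mem_divisors ha)).of_dvd_right
        (Nat.dvd_of_mem_divisors hb)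
    rw [Finset.sum_congr rfl this, ← Finset.sum_mul, Nat.divisors_prime_pow hps, Finset.sum_map,
      Finset.sum_range_succ', Finset.range_eq_Ico]
    have hI : ∑ j ∈ Finset.Ico 0 (v p), g (p ^ (j + 1)) = ∑ j ∈ Finset.Icc 1 (v p), g (p ^ j) :=
      Finset.sum_Ico_add' (fun j => g (p ^ j)) 0 (v p) 1
    simp only [Function.Embedding.coeFn_mk, pow_zero, h1, hI, add_comm]

theorem sum_inv_prime_pow_le {p : ℕ} (hp : p.Prime) (v : ℕ) :
    ∑ j ∈ Finset.Icc 1 v, 1 / (p : ℝ) ^ j ≤ 1 / ((p : ℝ) - 1) := by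
  have hp2 : (2 : ℝ) ≤ p := by exact_mod_cast hp.two_le
  have h : ∀ v : ℕ, ∑ j ∈ Finset.Icc 1 v, 1 / (p : ℝ) ^ j =
      (1 - 1 / (p : ℝ) ^ v) / ((p : ℝ) - 1) := by
    intro v
    induction v with
    | zero => simp
    | succ v ih =>
      rw [Finset.sum_Icc_succ_top (by omega), ih]
      have : (p : ℝ) - 1 ≠ 0 := by linarith
      field_simp
      ring
  rw [h]
  gcongr
  · linarith
  · simp

/-- The weight `e^(lam ω(n)) / n`. -/
noncomputable def expOmegaDiv (lam : ℝ) (n : ℕ) : ℝ := Real.exp (lam * n.primeFactors.card) / n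

theorem expOmegaDiv_nonneg (lam : ℝ) (n : ℕ) : 0 ≤ expOmegaDiv lam n := by
  unfold expOmegaDiv; positivity

theorem expOmegaDiv_one (lam : ℝ) : expOmegaDiv lam 1 = 1 := by simp [expOmegaDiv]

theorem expOmegaDiv_mul (lam : ℝ) {m n : ℕ} (h : m.Coprime n) :
    expOmegaDiv lam (m * n) = expOmegaDiv lam m * expOmegaDiv lam n := by
  rw [expOmegaDiv, h.primeFactors_mul, Finset.card_union_of_disjoint h.disjoint_primeFactors]
  push_cast
  rw [mul_add, Real.exp_add, expOmegaDiv, expOmegaDiv, mul_div_mul_comm]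

theorem expOmegaDiv_prime_pow (lam : ℝ) {p j : ℕ} (hp : p.Prime) (hj : 1 ≤ j) :
    expOmegaDiv lam (p ^ j) = Real.exp lam * (1 / (p : ℝ) ^ j) := by
  rw [expOmegaDiv, Nat.primeFactors_prime_pow (by omega) hp]
  simp
  rfl

theorem sum_expOmegaDiv_prime_pow_le (lam : ℝ) {p : ℕ} (hp : p.Prime) (v : ℕ) :
    ∑ j ∈ Finset.Icc 1 v, expOmegaDiv lam (p ^ j) ≤ Real.exp lam / ((p : ℝ) - 1) := by
  rw [Finset.sum_congr rfl fun j hj =>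
    expOmegaDiv_prime_pow lam hp (Finset.mem_Icc.mp hj).1, ← Finset.mul_sum, div_eq_mul_one_div]
  exact mul_le_mul_of_nonneg_left (sum_inv_prime_pow_le hp v) (Real.exp_pos _).le

theorem sum_divisors_expOmegaDiv_le (lam : ℝ) {s : Finset ℕ} (hs : ∀ p ∈ s, p.Prime)
    (v : ℕ → ℕ) :
    ∑ d ∈ (∏ p ∈ s, p ^ v p).divisors, expOmegaDiv lam d ≤
      ∏ p ∈ s, (1 + Real.exp lam / ((p : ℝ) - 1)) := by
  rw [sum_divisors_prod_prime_pow hs v (expOmegaDiv_one lam)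
    fun m n _ _ h => expOmegaDiv_mul lam h]
  refine Finset.prod_le_prod (fun p _ => ?_) (fun p hp => ?_)
  · exact add_nonneg zero_le_one (Finset.sum_nonneg fun j _ => expOmegaDiv_nonneg _ _)
  · exact add_le_add_right (sum_expOmegaDiv_prime_pow_le lam (hs p hp) _) _

/-- The condition `p ∣ d` deletes the term 1 from the Euler factor at `p`, leaving at most e^lam/(p
- 1). The factor at `p`, which is at least 1, is then put back so that the product no longer depends
on `p`. -/
theorem sum_divisors_expOmegaDiv_of_dvd_le (lam : ℝ) {s : Finset ℕ} (hs : ∀ p ∈ s, p.Prime)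
    (v : ℕ → ℕ) {p : ℕ} (hp : p ∈ s) :
    ∑ d ∈ (∏ q ∈ s, q ^ v q).divisors with p ∣ d, expOmegaDiv lam d ≤
      Real.exp lam / ((p : ℝ) - 1) * ∏ q ∈ s, (1 + Real.exp lam / ((q : ℝ) - 1)) := by
  have hpp := hs p hp
  have hp2 : (2 : ℝ) ≤ p := by exact_mod_cast hpp.two_le
  have hq0 : ∀ q ∈ s, 0 ≤ Real.exp lam / ((q : ℝ) - 1) := by
    intro q hq
    have : (2 : ℝ) ≤ q := by exact_mod_cast (hs q hq).two_le
    exact div_nonneg (Real.exp_pos _).le (by linarith)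
  have hs' : ∀ q ∈ s.erase p, q.Prime := fun q hq => hs q (Finset.mem_of_mem_erase hq)
  have hcop : (p ^ v p).Coprime (∏ q ∈ s.erase p, q ^ v q) :=
    Nat.Coprime.prod_right fun q hq => Nat.Coprime.pow _ _
      ((Nat.coprime_primes hpp (hs' q hq)).mpr (Finset.ne_of_mem_erase hq).symm)
  rw [← Finset.mul_prod_erase s _ hp, Finset.sum_filter, sum_divisors_mul_of_coprime hcop,
    ← Finset.mul_prod_erase s (fun q => 1 + Real.exp lam / ((q : ℝ) - 1)) hp]
  set N' := ∏ q ∈ s.erase p, q ^ v q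
  have h0 : (0 : ℝ) ≤ ∏ q ∈ s.erase p, (1 + Real.exp lam / ((q : ℝ) - 1)) :=
    Finset.prod_nonneg fun q hq => add_nonneg zero_le_one (hq0 q (Finset.mem_of_mem_erase hq))
  calc _ ≤ (∑ j ∈ Finset.Icc 1 (v p), expOmegaDiv lam (p ^ j)) *
        ∑ b ∈ N'.divisors, expOmegaDiv lam b := by
        rw [Nat.divisors_prime_pow hpp, Finset.sum_map, Finset.sum_range_succ']
        have hz : ∑ b ∈ N'.divisors, (if p ∣ p ^ 0 * b then expOmegaDiv lam (p ^ 0 * b) else 0)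
            = 0 := by
          refine Finset.sum_eq_zero fun b hb => if_neg fun hd => ?_
          rw [pow_zero, one_mul] at hd
          have hpN : p ∣ N' := hd.trans (Nat.dvd_of_mem_divisors hb)
          obtain ⟨q, hq, hpq⟩ := (Prime.dvd_finsetProd_iff hpp.prime _).mp hpN
          have := (Nat.prime_dvd_prime_iff_eq hpp (hs' q hq)).mp (hpp.dvd_of_dvd_pow hpq)
          exact Finset.ne_of_mem_erase hq this.symm
        have hI : ∑ j ∈ Finset.Icc 1 (v p), expOmegaDiv lam (p ^ j) =
            ∑ j ∈ Finset.range (v p), expOmegaDiv lam (p ^ (j + 1)) := by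
          rw [Finset.range_eq_Ico,
            Finset.sum_Ico_add' (fun j => expOmegaDiv lam (p ^ j)) 0 (v p) 1]
          rfl
        simp only [Function.Embedding.coeFn_mk]
        rw [hz, add_zero, hI, Finset.sum_mul]
        -- Coprimality to p^(v p) yields coprimality to `p` only for a positive exponent; for
        -- exponent 0 the sum over `j` is empty.
        by_cases hv : v p = 0
        · simp [hv]
        refine Finset.sum_le_sum fun j hj => ?_
        rw [Finset.mul_sum]
        refine Finset.sum_le_sum fun b hb => ?_
        rw [if_pos (Dvd.dvd.mul_right (dvd_pow_self p (Nat.succ_ne_zero j)) b)]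
        refine (expOmegaDiv_mul lam ?_).le
        exact ((Nat.coprime_pow_left_iff (Nat.pos_of_ne_zero hv) _ _).mp
          (hcop.of_dvd_right (Nat.dvd_of_mem_divisors hb))).pow_left _
    _ ≤ Real.exp lam / ((p : ℝ) - 1) *
        ∏ q ∈ s.erase p, (1 + Real.exp lam / ((q : ℝ) - 1)) := by
        gcongr
        · exact Finset.sum_nonneg fun _ _ => expOmegaDiv_nonneg _ _
        · exact hq0 p hp
        · exact sum_expOmegaDiv_prime_pow_le lam hpp _
        · exact sum_divisors_expOmegaDiv_le lam hs' v
    _ ≤ _ := by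
        refine mul_le_mul_of_nonneg_left ?_ (hq0 p hp)
        exact le_mul_of_one_le_left h0 (by linarith [hq0 p hp])

/-! ### The passage from Q_i to Q_{i+1} and the structure of a fibre. -/

theorem mem_primesIoc {a b : ℝ} {p : ℕ} :
    p ∈ primesIoc a b ↔ p.Prime ∧ a < p ∧ (p : ℝ) ≤ b := by
  simp only [primesIoc, Finset.mem_filter, Finset.mem_range, Nat.lt_succ_iff,
    and_iff_right_iff_imp]
  exact fun h => Nat.le_floor h.2.2

theorem primesIoc_union {a b c : ℝ} (hab : a ≤ b) (hbc : b ≤ c) :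
    primesIoc a c = primesIoc a b ∪ primesIoc b c := by
  ext p
  simp only [Finset.mem_union, mem_primesIoc]
  constructor
  · rintro ⟨h1, h2, h3⟩
    rcases le_or_gt (p : ℝ) b with h | h
    · exact Or.inl ⟨h1, h2, h⟩
    · exact Or.inr ⟨h1, h, h3⟩
  · rintro (⟨h1, h2, h3⟩ | ⟨h1, h2, h3⟩)
    · exact ⟨h1, h2, h3.trans hbc⟩
    · exact ⟨h1, hab.trans_lt h2, h3⟩

theorem disjoint_primesIoc (a b c : ℝ) : Disjoint (primesIoc a b) (primesIoc b c) := by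
  rw [Finset.disjoint_left]
  intro p h1 h2
  exact (mem_primesIoc.mp h2).2.1.not_ge (mem_primesIoc.mp h1).2.2

namespace CongruenceSystem

variable (C : CongruenceSystem) (P : ℕ → ℝ)

/-- `Q_{i+1} / Q_i`, the part of `Q` supported on the primes in `(P_i, P_{i+1}]`. -/
noncomputable def newModulus (i : ℕ) : ℕ :=
  ∏ p ∈ primesIoc (P i) (P (i + 1)), p ^ padicValNat p C.totalModulus

theorem Q_pos (i : ℕ) : 0 < C.Q P i :=
  Finset.prod_pos fun _ hp => pow_pos (mem_primesIoc.mp hp).1.pos _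

theorem newModulus_pos (i : ℕ) : 0 < C.newModulus P i :=
  Finset.prod_pos fun _ hp => pow_pos (mem_primesIoc.mp hp).1.pos _

variable {C P} {i : ℕ}

theorem Q_succ (h0 : 0 ≤ P i) (h1 : P i ≤ P (i + 1)) :
    C.Q P (i + 1) = C.Q P i * C.newModulus P i := by
  rw [Q, primesIoc_union h0 h1, Finset.prod_union (disjoint_primesIoc _ _ _)]
  rfl

theorem mem_primesIoc_of_dvd_newModulus {p : ℕ} (hp : p.Prime) (h : p ∣ C.newModulus P i) :
    p ∈ primesIoc (P i) (P (i + 1)) := by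
  obtain ⟨q, hq, hpq⟩ := (Prime.dvd_finsetProd_iff hp.prime _).mp h
  rwa [(Nat.prime_dvd_prime_iff_eq hp (mem_primesIoc.mp hq).1).mp (hp.dvd_of_dvd_pow hpq)]

theorem primeFactors_subset_of_dvd_newModulus {n : ℕ} (h : n ∣ C.newModulus P i) :
    n.primeFactors ⊆ primesIoc (P i) (P (i + 1)) := fun _ hp =>
  mem_primesIoc_of_dvd_newModulus (Nat.prime_of_mem_primeFactors hp)
    ((Nat.dvd_of_mem_primeFactors hp).trans h)

theorem coprime_Q_of_primes {n : ℕ} (h : ∀ p : ℕ, p.Prime → p ∣ n → P i < p) :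
    n.Coprime (C.Q P i) := by
  refine Nat.Coprime.prod_right fun q hq => Nat.Coprime.pow_right _ ?_
  obtain ⟨hq1, -, hq3⟩ := mem_primesIoc.mp hq
  exact ((Nat.Prime.coprime_iff_not_dvd hq1).mpr fun hd => (h q hq1 hd).not_ge hq3).symm

theorem coprime_newModulus_Q : (C.newModulus P i).Coprime (C.Q P i) :=
  coprime_Q_of_primes fun _ hp hd => (mem_primesIoc.mp (mem_primesIoc_of_dvd_newModulus hp hd)).2.1

theorem mem_newFactors (h0 : 0 ≤ P i) (h1 : P i ≤ P (i + 1)) {n : ℕ} :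
    n ∈ C.newFactors P i ↔ n ∣ C.newModulus P i ∧ 1 < n := by
  simp only [newFactors, Finset.mem_filter, Nat.mem_divisors]
  constructor
  · rintro ⟨⟨hd, -⟩, hn, hp⟩
    rw [Q_succ h0 h1] at hd
    exact ⟨(coprime_Q_of_primes fun p hp' hpn => (hp p hp' hpn).1).dvd_of_dvd_mul_left hd, hn⟩
  · rintro ⟨hd, hn⟩
    refine ⟨⟨?_, (C.Q_pos P (i + 1)).ne'⟩, hn, fun p hp hpn => ?_⟩
    · rw [Q_succ h0 h1]
      exact hd.mul_left _
    · exact (mem_primesIoc.mp (mem_primesIoc_of_dvd_newModulus hp (hpn.trans hd))).2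

theorem definedMod_R (i : ℕ) : DefinedMod (C.Q P i) (C.R P i) := by
  intro x y hxy
  refine forall_congr' fun m => forall_congr' fun hm => not_congr ?_
  exact ((definedMod_residueClass _ m).of_dvd (Finset.mem_filter.mp hm).2) x y hxy

theorem definedMod_removed (n : ℕ) (r : ℤ) :
    DefinedMod (n * C.Q P i) (C.removed P i n r) := by
  refine ((definedMod_residueClass r _).of_dvd (dvd_mul_left _ _)).inter fun x y hxy => ?_
  refine exists_congr fun m₀ => and_congr_right fun hm₀ => and_congr_right fun _ => ?_
  refine ((definedMod_residueClass _ (m₀ * n)).of_dvd ?_) x y hxy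
  rw [mul_comm n]
  exact mul_dvd_mul_right hm₀ n

/-- Each modulus of stage i + 1 factors as m₀ n with m₀ ∣ Q_i and n ∣ Q_{i+1}/Q_i. Those with n = 1
belong to stage i, and z ≡ r avoids them because r ∈ R_i. -/
theorem mem_R_succ_iff (h0 : 0 ≤ P i) (h1 : P i ≤ P (i + 1)) {r z : ℤ} (hr : r ∈ C.R P i)
    (hz : z ∈ residueClass r (C.Q P i)) :
    z ∈ C.R P (i + 1) ↔ ∀ n ∈ C.newFactors P i, z ∉ C.removed P i n r := by
  constructor
  · rintro h n - ⟨-, m₀, -, hm, hzm⟩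
    exact h _ hm hzm
  · intro h m hm hzm
    obtain ⟨hmC, hmQ⟩ := Finset.mem_filter.mp hm
    rw [Q_succ h0 h1, Nat.dvd_mul] at hmQ
    obtain ⟨m₀, n, hm₀, hn, rfl⟩ := hmQ
    have hn0 := Nat.pos_of_dvd_of_pos hn (C.newModulus_pos P i)
    rcases (Nat.succ_le_iff.mpr hn0).eq_or_lt with hn1 | hn1
    · have hz' : z ∈ C.R P i := (definedMod_R i z r hz).mpr hr
      refine hz' _ (Finset.mem_filter.mpr ⟨hmC, ?_⟩) hzm
      rw [← hn1]
      simpa using hm₀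
    · exact h n ((mem_newFactors h0 h1).mpr ⟨hn, hn1⟩) ⟨hz, m₀, hm₀, hm, hzm⟩

theorem add_mul_mem_residueClass (r t : ℤ) (q : ℕ) : r + q * t ∈ residueClass r q := by
  simp [residueClass, Int.ModEq]

variable (C P) in
/-- `A_{n,r}`, in the coordinate `t` of the points `r + Q_i t` of the fibre. -/
def fibreRemoved (i : ℕ) (r : ℤ) (n : ℕ) : Set ℤ := {t | r + C.Q P i * t ∈ C.removed P i n r}

theorem definedMod_fibreRemoved (r : ℤ) (n : ℕ) : DefinedMod n (C.fibreRemoved P i r n) :=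
  (definedMod_removed n r).preimage_fibre r

theorem residueCount_removed {n : ℕ} (hn : 0 < n) (r : ℤ) :
    residueCount (n * C.Q P i) (C.removed P i n r) = countMod n (C.fibreRemoved P i r n) :=
  residueCount_fibre hn (C.Q_pos P i) r (definedMod_removed n r) Set.inter_subset_left

/-- This brings a fibre into the form of the local lemma: the support condition in `sifted` is
vacuous when all new primes are allowed. -/
theorem fibre_R_succ_eq_sifted (h0 : 0 ≤ P i) (h1 : P i ≤ P (i + 1)) {r : ℤ}
    (hr : r ∈ C.R P i) :
    {t : ℤ | r + C.Q P i * t ∈ C.R P (i + 1)} =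
      sifted (C.newFactors P i) (C.fibreRemoved P i r) (primesIoc (P i) (P (i + 1))) := by
  ext t
  rw [Set.mem_ofPred_eq, mem_R_succ_iff h0 h1 hr (add_mul_mem_residueClass _ _ _)]
  refine forall_congr' fun n => forall_congr' fun hn => ?_
  have := primeFactors_subset_of_dvd_newModulus ((mem_newFactors h0 h1).mp hn).1
  simp [this, fibreRemoved]

theorem residueCount_fibrePart (h0 : 0 ≤ P i) (h1 : P i ≤ P (i + 1)) (r : ℤ) :
    residueCount (C.Q P (i + 1)) (C.fibrePart P i r) =
      countMod (C.newModulus P i) {t : ℤ | r + C.Q P i * t ∈ C.R P (i + 1)} := by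
  have hd : DefinedMod (C.newModulus P i * C.Q P i) (C.fibrePart P i r) := by
    refine DefinedMod.inter ?_ ((definedMod_residueClass r _).of_dvd (dvd_mul_left _ _))
    rw [mul_comm, ← Q_succ h0 h1]
    exact definedMod_R _
  rw [Q_succ h0 h1, mul_comm,
    residueCount_fibre (C.newModulus_pos P i) (C.Q_pos P i) r hd Set.inter_subset_right]
  congr 1
  ext t
  simp [fibrePart, add_mul_mem_residueClass]

theorem IsGood.sum_le {lam : ℝ} {r : ℤ} (h : C.IsGood P i lam r) :
    ∀ p ∈ primesIoc (P i) (P (i + 1)), ∑ n ∈ C.newFactors P i with p ∣ n,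
      (countMod n (C.fibreRemoved P i r n) : ℝ) * Real.exp (lam * n.primeFactors.card) / n ≤
        1 - Real.exp (-lam) := by
  intro p hp
  refine le_of_eq_of_le (Finset.sum_congr rfl fun n hn => ?_) (h p hp)
  have hn1 : 1 < n := by
    classical
    exact (Finset.mem_filter.mp (Finset.mem_filter.mp hn).1).2.1
  rw [residueCount_removed (by omega)]

theorem residueCount_fibrePart_pos (h0 : 0 ≤ P i) (h1 : P i ≤ P (i + 1)) {r : ℤ}
    (hr : r ∈ C.R P i) {lam : ℝ} (hlam : 0 < lam) (h : C.IsGood P i lam r) :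
    0 < residueCount (C.Q P (i + 1)) (C.fibrePart P i r) := by
  rw [residueCount_fibrePart h0 h1, fibre_R_succ_eq_sifted h0 h1 hr]
  exact countMod_sifted_pos (C.newModulus_pos P i) (fun n hn => (mem_newFactors h0 h1).mp hn)
    (fun n _ => definedMod_fibreRemoved r n) hlam (fun p hp => (mem_primesIoc.mp hp).1) h.sum_le

/-- In a good fibre, a residue class modulo `m₀ n` captures at most the proportion
`e^(lam ω(n)) / n`. -/
theorem countMod_fibre_residueClass_le (h0 : 0 ≤ P i) (h1 : P i ≤ P (i + 1)) {r : ℤ}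
    (hr : r ∈ C.R P i) {lam : ℝ} (hlam : 0 < lam) (h : C.IsGood P i lam r) {n : ℕ}
    (hn : n ∣ C.newModulus P i) (b : ℤ) :
    (countMod (C.newModulus P i)
      {t : ℤ | r + C.Q P i * t ∈ C.R P (i + 1) ∩ residueClass b n} : ℝ) ≤
      expOmegaDiv lam n * residueCount (C.Q P (i + 1)) (C.fibrePart P i r) := by
  have heq : {t : ℤ | r + C.Q P i * t ∈ C.R P (i + 1) ∩ residueClass b n} =
      {t : ℤ | r + C.Q P i * t ∈ residueClass b n} ∩
        {t : ℤ | r + C.Q P i * t ∈ C.R P (i + 1)} := by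
    ext t
    exact and_comm
  rw [heq, residueCount_fibrePart h0 h1, fibre_R_succ_eq_sifted h0 h1 hr]
  have hX : DefinedMod n {t : ℤ | r + C.Q P i * t ∈ residueClass b n} :=
    ((definedMod_residueClass b n).of_dvd (dvd_mul_right _ _)).preimage_fibre r
  refine (countMod_inter_sifted_le (C.newModulus_pos P i)
    (fun n hn => ((mem_newFactors h0 h1).mp hn).1) (fun n _ => definedMod_fibreRemoved r n) hlam
    (fun p hp => (mem_primesIoc.mp hp).1) h.sum_le hn (primeFactors_subset_of_dvd_newModulus hn)
    hX).trans ?_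
  have hle : (countMod n {t : ℤ | r + C.Q P i * t ∈ residueClass b n} : ℝ) ≤ 1 := by
    exact_mod_cast countMod_linear_le_one (coprime_newModulus_Q.of_dvd_left hn) r b
  have he := expOmegaDiv_nonneg lam n
  refine mul_le_mul_of_nonneg_right ?_ (Nat.cast_nonneg _)
  exact mul_le_of_le_one_left he hle

theorem isGood_congr {lam : ℝ} {r s : ℤ} (h : r ≡ s [ZMOD C.Q P i]) :
    C.IsGood P i lam r ↔ C.IsGood P i lam s := by
  have : ∀ n, C.removed P i n r = C.removed P i n s := fun n => by
    rw [removed, removed, residueClass_eq h]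
  simp only [IsGood, this]

theorem fibrePart_congr {r s : ℤ} (h : r ≡ s [ZMOD C.Q P i]) :
    C.fibrePart P i r = C.fibrePart P i s := by
  rw [fibrePart, fibrePart, residueClass_eq h]

/-! ### Masses, bias statistics and moments. -/

section mass

variable {w : ℤ → ℝ}

theorem mass_eq_sum (X : Set ℤ) [DecidablePred (· ∈ X)] :
    C.mass P i w X = ∑ r ∈ Finset.range (C.Q P i), if ((r : ℕ) : ℤ) ∈ X then w r else 0 := by
  classical
  -- In `mass` the index is an integer, so the range there is the image of `Finset.range` in ℤ. The
  -- cast is injective, and the sum may run over natural numbers.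
  have h : (do let a ← Finset.range (C.Q P i); pure (a : ℤ) : Finset ℤ) =
      (Finset.range (C.Q P i)).image (fun a : ℕ => (a : ℤ)) := by
    ext z
    simp [eq_comm]
  rw [mass, Finset.sum_filter]
  trans ∑ a ∈ (do let a ← Finset.range (C.Q P i); pure (a : ℤ) : Finset ℤ),
    if a ∈ X then w a else 0
  · congr!
  · rw [h, Finset.sum_image fun a _ b _ hab => by exact_mod_cast hab]

theorem mass_mono (hw : ∀ r, 0 ≤ w r) {X Y : Set ℤ} (h : X ⊆ Y) :
    C.mass P i w X ≤ C.mass P i w Y := by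
  classical
  rw [mass_eq_sum, mass_eq_sum]
  refine Finset.sum_le_sum fun r _ => ?_
  by_cases hr : (r : ℤ) ∈ X
  · rw [if_pos hr, if_pos (h hr)]
  · rw [if_neg hr]
    split_ifs
    exacts [hw _, le_rfl]

theorem mass_nonneg (hw : ∀ r, 0 ≤ w r) (X : Set ℤ) : 0 ≤ C.mass P i w X :=
  Finset.sum_nonneg fun r _ => hw r

theorem mass_pos (hw : ∀ r, 0 ≤ w r) {X : Set ℤ} (hX : DefinedMod (C.Q P i) X)
    (hwX : ∀ r ∈ X, 0 < w r) (hne : X.Nonempty) : 0 < C.mass P i w X := by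
  classical
  obtain ⟨x, hx⟩ := hne
  have hQ : (0 : ℤ) < C.Q P i := by exact_mod_cast C.Q_pos P i
  obtain ⟨t, ht⟩ := Int.eq_ofNat_of_zero_le (Int.emod_nonneg x hQ.ne')
  have htx : (t : ℤ) ≡ x [ZMOD C.Q P i] := ht ▸ Int.mod_modEq x (C.Q P i)
  have htX : (t : ℤ) ∈ X := (hX t x htx).mpr hx
  have hlt := Int.emod_lt_of_pos x hQ
  rw [mass_eq_sum]
  refine Finset.sum_pos' (fun r _ => ?_) ⟨t, Finset.mem_range.mpr (by omega), ?_⟩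
  · split_ifs
    exacts [hw _, le_rfl]
  · rw [if_pos htX]
    exact hwX t htX

theorem bias_term_le {X : Set ℤ} {m : ℕ} (hm : 0 < m) (b : ℤ) :
    C.mass P i w (X ∩ residueClass b m) / C.mass P i w X ≤
      ⨆ b : Fin m, C.mass P i w (X ∩ residueClass (b : ℕ) m) / C.mass P i w X := by
  have hm' : (0 : ℤ) < m := by exact_mod_cast hm
  obtain ⟨t, ht⟩ := Int.eq_ofNat_of_zero_le (Int.emod_nonneg b hm'.ne')
  have hlt := Int.emod_lt_of_pos b hm'
  have hcl : residueClass b m = residueClass ((⟨t, by omega⟩ : Fin m) : ℕ) m := by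
    refine residueClass_eq ?_
    have := Int.mod_modEq b m
    rw [ht] at this
    exact this.symm
  rw [hcl]
  exact le_ciSup (f := fun b : Fin m => C.mass P i w (X ∩ residueClass (b : ℕ) m) /
    C.mass P i w X) (Set.finite_range _).bddAbove _

theorem iSup_bias_nonneg (hw : ∀ r, 0 ≤ w r) (X : Set ℤ) (m : ℕ) :
    0 ≤ ⨆ b : Fin m, C.mass P i w (X ∩ residueClass (b : ℕ) m) / C.mass P i w X :=
  Real.iSup_nonneg fun _ => div_nonneg (mass_nonneg hw _) (mass_nonneg hw _)

theorem biasPow_nonneg (hw : ∀ r, 0 ≤ w r) (X : Set ℤ) (k : ℕ) : 0 ≤ C.biasPow P i w X k :=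
  Finset.sum_nonneg fun m _ => mul_nonneg (Nat.cast_nonneg _) (iSup_bias_nonneg hw X m)

theorem bias_pow (hw : ∀ r, 0 ≤ w r) (X : Set ℤ) {k : ℕ} (hk : 1 ≤ k) :
    C.bias P i w X k ^ k = C.biasPow P i w X k := by
  rw [bias, one_div]
  exact Real.rpow_inv_natCast_pow (biasPow_nonneg hw X k) (by omega)

/-- The `k`-th moment of the number of classes `a_m mod m`, `m ∣ Q_i`, containing a point. -/
theorem moment_classes_le (hw : ∀ r, 0 ≤ w r) {X : Set ℤ} (hX : 0 < C.mass P i w X)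
    (a : ℕ → ℤ) (k : ℕ) [∀ m, DecidablePred (· ∈ residueClass (a m) m)]
    [DecidablePred (· ∈ X)] :
    ∑ r ∈ Finset.range (C.Q P i) with ((r : ℕ) : ℤ) ∈ X,
      w r * (∑ m ∈ (C.Q P i).divisors, if (r : ℤ) ∈ residueClass (a m) m then (1 : ℝ) else 0) ^ k ≤
      C.mass P i w X * C.biasPow P i w X k := by
  classical
  -- Expanding the power produces k-tuples of divisors; grouping them by their lcm produces the
  -- coefficients ℓ_k of the bias statistic.
  have hexp : ∀ r : ℕ, (∑ m ∈ (C.Q P i).divisors,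
      if (r : ℤ) ∈ residueClass (a m) m then (1 : ℝ) else 0) ^ k =
      ∑ f ∈ Fintype.piFinset (fun _ : Fin k => (C.Q P i).divisors),
        if ∀ j, (r : ℤ) ∈ residueClass (a (f j)) (f j) then (1 : ℝ) else 0 := by
    intro r
    have h := Finset.prod_univ_sum (fun _ : Fin k => (C.Q P i).divisors)
      (fun _ m => if (r : ℤ) ∈ residueClass (a m) m then (1 : ℝ) else 0)
    rw [Finset.prod_const, Finset.card_univ, Fintype.card_fin] at h
    rw [h]
    refine Finset.sum_congr rfl fun f _ => ?_
    rw [Fintype.prod_ite_zero]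
    simp
  simp only [hexp, Finset.mul_sum]
  rw [Finset.sum_comm, biasPow, ← sum_piFinset_divisors_lcm k (C.Q_pos P i), Finset.mul_sum]
  refine Finset.sum_le_sum fun f hf => ?_
  rw [Fintype.mem_piFinset] at hf
  set L := Finset.univ.lcm f with hL
  have hL0 : 0 < L := Nat.pos_of_dvd_of_pos
    (Finset.lcm_dvd fun j _ => Nat.dvd_of_mem_divisors (hf j)) (C.Q_pos P i)
  -- If the classes of the tuple share a point `b`, all their common points lie in the class of `b`
  -- modulo the lcm; otherwise the tuple contributes nothing.
  by_cases hne : ∃ b : ℤ, ∀ j, b ∈ residueClass (a (f j)) (f j)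
  · obtain ⟨b, hb⟩ := hne
    have hcl : ∀ r : ℤ, (∀ j, r ∈ residueClass (a (f j)) (f j)) → r ∈ residueClass b L := by
      intro r hr
      refine (Int.modEq_iff_dvd.mpr ?_)
      rw [Int.natCast_dvd, hL]
      refine Finset.lcm_dvd fun j _ => ?_
      rw [← Int.natCast_dvd]
      exact Int.modEq_iff_dvd.mp (Int.ModEq.trans (hr j) (Int.ModEq.symm (hb j)))
    calc _ ≤ C.mass P i w (X ∩ residueClass b L) := by
          rw [mass_eq_sum, Finset.sum_filter]
          refine Finset.sum_le_sum fun r _ => ?_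
          by_cases hr : (r : ℤ) ∈ X
          · by_cases hr' : ∀ j, (r : ℤ) ∈ residueClass (a (f j)) (f j)
            · rw [if_pos hr, if_pos hr', if_pos ⟨hr, hcl _ hr'⟩, mul_one]
            · rw [if_pos hr, if_neg hr', mul_zero]
              split_ifs
              · exact hw _
              · exact le_rfl
          · rw [if_neg hr]
            split_ifs
            · exact hw _
            · exact le_rfl
      _ = C.mass P i w X * (C.mass P i w (X ∩ residueClass b L) / C.mass P i w X) := by
          field_simp
      _ ≤ _ := mul_le_mul_of_nonneg_left (bias_term_le hL0 b) hX.le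
  · rw [Finset.sum_eq_zero]
    · exact mul_nonneg hX.le (iSup_bias_nonneg hw X _)
    · intro r _
      rw [if_neg fun h => hne ⟨r, h⟩, mul_zero]

end mass

end CongruenceSystem

/-- Jensen's inequality for x ↦ x^k with the normalized weights c_n/∑c. Vanishing total weight is
treated separately, as it cannot be normalized. -/
theorem sum_mul_pow_le {ι : Type*} (s : Finset ι) (c x : ι → ℝ) (hc : ∀ n ∈ s, 0 ≤ c n)
    (hx : ∀ n ∈ s, 0 ≤ x n) {k : ℕ} (hk : 1 ≤ k) :
    (∑ n ∈ s, c n * x n) ^ k ≤ (∑ n ∈ s, c n) ^ (k - 1) * ∑ n ∈ s, c n * x n ^ k := by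
  obtain ⟨l, rfl⟩ := Nat.exists_eq_add_of_le' hk
  rw [Nat.add_sub_cancel]
  rcases (Finset.sum_nonneg hc).eq_or_lt with h | h
  · have h0 := (Finset.sum_eq_zero_iff_of_nonneg hc).mp h.symm
    rw [Finset.sum_eq_zero fun n hn => by rw [h0 n hn, zero_mul],
      Finset.sum_eq_zero (f := fun n => c n * x n ^ (l + 1))
        fun n hn => by rw [h0 n hn, zero_mul]]
    simp
  · set c₀ := ∑ n ∈ s, c n
    have hJ := Real.pow_arith_mean_le_arith_mean_pow s (fun n => c n / c₀) x
      (fun n hn => div_nonneg (hc n hn) h.le) (by rw [← Finset.sum_div, div_self h.ne']) hx (l + 1)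
    simp only [div_mul_eq_mul_div] at hJ
    rw [← Finset.sum_div, ← Finset.sum_div, div_pow, div_le_div_iff₀ (by positivity) h] at hJ
    rw [pow_succ c₀ l, ← mul_assoc] at hJ
    exact (le_of_mul_le_mul_right hJ h).trans_eq (mul_comm _ _)

/-! ### The measures μ_i and the growth of the bias. -/

namespace CongruenceSystem

variable {C : CongruenceSystem} {P : ℕ → ℝ} {i : ℕ}

section weight

variable {S : ℕ → Set ℤ}

theorem definedMod_stage_set (hP : StrictMono P) (h0 : 0 ≤ P 0) (hS0 : S 0 = Set.univ)
    (hS : ∀ j < i, S (j + 1) ⊆ S j ∩ C.R P j ∧ DefinedMod (C.Q P j) (S (j + 1))) :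
    DefinedMod (C.Q P i) (S i) := by
  cases i with
  | zero => rw [hS0]; exact fun _ _ _ => Iff.rfl
  | succ j =>
    refine (hS j (Nat.lt_succ_self j)).2.of_dvd ?_
    rw [Q_succ (h0.trans (hP.monotone (Nat.zero_le j))) (hP.monotone (Nat.le_succ j))]
    exact dvd_mul_right _ _

theorem weight_nonneg (i : ℕ) (r : ℤ) : 0 ≤ C.weight P S i r := by
  induction i generalizing r with
  | zero => simp only [weight, initialWeight]; split_ifs <;> positivity
  | succ i ih =>
    simp only [weight, nextWeight]
    split_ifs
    · exact div_nonneg (ih r) (Nat.cast_nonneg _)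
    · exact le_rfl

/-- No goodness of earlier stages is needed: `r` itself lies in each fibre part among which its
weight is shared, so no denominator vanishes. -/
theorem weight_pos
    (hS : ∀ j < i, S (j + 1) ⊆ S j ∩ C.R P j ∧ DefinedMod (C.Q P j) (S (j + 1))) {r : ℤ}
    (hr : r ∈ S i ∩ C.R P i) : 0 < C.weight P S i r := by
  induction i with
  | zero =>
    simp only [weight, initialWeight]
    rw [if_pos hr.2]
    exact one_div_pos.mpr (Nat.cast_pos.mpr (residueCount_pos (C.Q_pos P 0) ⟨r, hr.2⟩))
  | succ i ih =>
    simp only [weight, nextWeight]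
    rw [if_pos hr]
    refine div_pos (ih (fun j hj => hS j (by omega)) ((hS i (by omega)).1 hr.1)) ?_
    exact Nat.cast_pos.mpr (residueCount_pos (C.Q_pos P _) ⟨r, hr.2, Int.ModEq.refl r⟩)

theorem weight_congr (hP : StrictMono P) (h0 : 0 ≤ P 0)
    (hS : ∀ j < i, S (j + 1) ⊆ S j ∩ C.R P j ∧ DefinedMod (C.Q P j) (S (j + 1))) {r s : ℤ}
    (h : r ≡ s [ZMOD C.Q P i]) : C.weight P S i r = C.weight P S i s := by
  induction i with
  | zero =>
    simp only [weight, initialWeight]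
    classical exact if_congr (definedMod_R 0 r s h) rfl rfl
  | succ i ih =>
    have hdvd : C.Q P i ∣ C.Q P (i + 1) := by
      rw [Q_succ (h0.trans (hP.monotone (Nat.zero_le i))) (hP.monotone (Nat.le_succ i))]
      exact dvd_mul_right _ _
    have h' : r ≡ s [ZMOD C.Q P i] := h.of_dvd (Int.natCast_dvd_natCast.mpr hdvd)
    have hT : r ∈ S (i + 1) ∩ C.R P (i + 1) ↔ s ∈ S (i + 1) ∩ C.R P (i + 1) :=
      and_congr ((hS i (by omega)).2 r s h') (definedMod_R (i + 1) r s h)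
    simp only [weight, nextWeight, fibrePart_congr h', ih (fun j hj => hS j (by omega)) h']
    classical exact if_congr hT rfl rfl

end weight

/-- The substitution z = r + Q_i t turns mass at stage i + 1 into weighted counts in fibres. `Y =
Set.univ` gives the total mass, and a residue class as `Y` gives the numerators of the bias. -/
theorem mass_next (h0 : 0 ≤ P i) (h1 : P i ≤ P (i + 1)) {w : ℤ → ℝ}
    (hw : ∀ r s : ℤ, r ≡ s [ZMOD C.Q P i] → w r = w s) {T : Set ℤ}
    (hT : DefinedMod (C.Q P i) T) (Y : Set ℤ) [DecidablePred (· ∈ T)] :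
    C.mass P (i + 1) (C.nextWeight P i T w) (T ∩ C.R P (i + 1) ∩ Y) =
      ∑ r ∈ Finset.range (C.Q P i), if ((r : ℕ) : ℤ) ∈ T then
        w r / residueCount (C.Q P (i + 1)) (C.fibrePart P i r) *
          countMod (C.newModulus P i) {t : ℤ | r + C.Q P i * t ∈ C.R P (i + 1) ∩ Y} else 0 := by
  classical
  rw [mass_eq_sum, Q_succ h0 h1, sum_range_mul]
  refine Finset.sum_congr rfl fun r _ => ?_
  have hmod : ∀ t : ℕ, ((r + C.Q P i * t : ℕ) : ℤ) ≡ r [ZMOD C.Q P i] := fun t => by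
    push_cast; exact add_mul_mem_residueClass _ _ _
  have hTr : ∀ t : ℕ, ((r + C.Q P i * t : ℕ) : ℤ) ∈ T ↔ (r : ℤ) ∈ T := fun t =>
    hT _ _ (hmod t)
  by_cases hr : (r : ℤ) ∈ T
  · rw [if_pos hr, countMod_eq_sum, Nat.cast_sum, Finset.mul_sum]
    refine Finset.sum_congr rfl fun t _ => ?_
    have hmem : ((t : ℕ) : ℤ) ∈ {t : ℤ | (r : ℤ) + C.Q P i * t ∈ C.R P (i + 1) ∩ Y} ↔
      ((r + C.Q P i * t : ℕ) : ℤ) ∈ C.R P (i + 1) ∩ Y := by push_cast; exact Iff.rfl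
    by_cases ht : ((r + C.Q P i * t : ℕ) : ℤ) ∈ C.R P (i + 1) ∩ Y
    · rw [if_pos ⟨⟨(hTr t).mpr hr, ht.1⟩, ht.2⟩, if_pos (hmem.mpr ht), nextWeight,
        if_pos ⟨(hTr t).mpr hr, ht.1⟩, hw _ _ (hmod t), fibrePart_congr (hmod t), Q_succ h0 h1]
      simp
    · rw [if_neg fun h => ht ⟨h.1.2, h.2⟩, if_neg fun h => ht (hmem.mp h)]
      simp
  · rw [if_neg hr]
    exact Finset.sum_eq_zero fun t _ => if_neg fun h => hr ((hTr t).mp h.1.1)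

/-- Passing to the next stage keeps the mass of a set of good fibres. -/
theorem mass_next_eq (h0 : 0 ≤ P i) (h1 : P i ≤ P (i + 1)) {w : ℤ → ℝ}
    (hw : ∀ r s : ℤ, r ≡ s [ZMOD C.Q P i] → w r = w s) {T : Set ℤ}
    (hT : DefinedMod (C.Q P i) T) (hTR : T ⊆ C.R P i) {lam : ℝ} (hlam : 0 < lam)
    (hgood : ∀ r ∈ T, C.IsGood P i lam r) :
    C.mass P (i + 1) (C.nextWeight P i T w) (T ∩ C.R P (i + 1)) = C.mass P i w T := by
  classical
  have h := mass_next h0 h1 hw hT Set.univ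
  simp only [Set.inter_univ] at h
  rw [h, mass_eq_sum]
  refine Finset.sum_congr rfl fun r _ => ?_
  by_cases hr : (r : ℤ) ∈ T
  · rw [if_pos hr, if_pos hr, ← residueCount_fibrePart h0 h1]
    -- Goodness enters here: an empty fibre would lose the weight of `r`, since the quotient by 0 is
    -- 0.
    have := residueCount_fibrePart_pos h0 h1 (hTR hr) hlam (hgood r hr)
    field_simp
  · rw [if_neg hr, if_neg hr]

/-- As m ∣ Q_i, the congruence modulo `m` is constant on a fibre: it selects fibres. In a selected
good fibre only the congruence modulo `n` is kept, and the local lemma bounds its proportion. -/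
theorem mass_next_residueClass_le (h0 : 0 ≤ P i) (h1 : P i ≤ P (i + 1)) {w : ℤ → ℝ}
    (hw0 : ∀ r, 0 ≤ w r) (hw : ∀ r s : ℤ, r ≡ s [ZMOD C.Q P i] → w r = w s) {T : Set ℤ}
    (hT : DefinedMod (C.Q P i) T) (hTR : T ⊆ C.R P i) {lam : ℝ} (hlam : 0 < lam)
    (hgood : ∀ r ∈ T, C.IsGood P i lam r) {m n : ℕ} (hm : m ∣ C.Q P i)
    (hn : n ∣ C.newModulus P i) (b : ℤ) :
    C.mass P (i + 1) (C.nextWeight P i T w) (T ∩ C.R P (i + 1) ∩ residueClass b (m * n)) ≤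
      expOmegaDiv lam n * C.mass P i w (T ∩ residueClass b m) := by
  classical
  rw [mass_next h0 h1 hw hT, mass_eq_sum, Finset.mul_sum]
  refine Finset.sum_le_sum fun r _ => ?_
  by_cases hr : (r : ℤ) ∈ T
  swap
  · rw [if_neg hr, if_neg fun h => hr h.1, mul_zero]
  have hf := residueCount_fibrePart_pos h0 h1 (hTR hr) hlam (hgood r hr)
  have hf' : (0 : ℝ) < residueCount (C.Q P (i + 1)) (C.fibrePart P i r) := by exact_mod_cast hf
  rw [if_pos hr]
  by_cases hrb : (r : ℤ) ∈ residueClass b m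
  · rw [if_pos ⟨hr, hrb⟩]
    have hle : (countMod (C.newModulus P i)
        {t : ℤ | r + C.Q P i * t ∈ C.R P (i + 1) ∩ residueClass b (m * n)} : ℝ) ≤
        expOmegaDiv lam n * residueCount (C.Q P (i + 1)) (C.fibrePart P i r) := by
      refine le_trans ?_ (countMod_fibre_residueClass_le h0 h1 (hTR hr) hlam (hgood r hr) hn b)
      refine Nat.cast_le.mpr (countMod_mono fun t ht => ⟨ht.1, ?_⟩)
      exact Int.ModEq.of_dvd (Int.natCast_dvd_natCast.mpr (dvd_mul_left n m)) ht.2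
    refine (mul_le_mul_of_nonneg_left hle (div_nonneg (hw0 _) hf'.le)).trans_eq ?_
    field_simp
  · rw [if_neg fun h => hrb h.2, mul_zero]
    have : countMod (C.newModulus P i)
        {t : ℤ | r + C.Q P i * t ∈ C.R P (i + 1) ∩ residueClass b (m * n)} = 0 := by
      refine Nat.le_zero.mp ((countMod_mono (Y := ∅) fun t ht => hrb ?_).trans_eq (by simp [countMod]))
      have h2 : (r : ℤ) + C.Q P i * t ≡ b [ZMOD m] :=
        Int.ModEq.of_dvd (Int.natCast_dvd_natCast.mpr (dvd_mul_right m n)) ht.2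
      have h3 : (r : ℤ) + C.Q P i * t ≡ r [ZMOD m] :=
        Int.ModEq.of_dvd (Int.natCast_dvd_natCast.mpr hm) (add_mul_mem_residueClass _ _ _)
      exact h3.symm.trans h2
    rw [this]
    simp

theorem lcmTuple_expOmegaDiv_sum {k : ℕ} (hk : 1 ≤ k) (lam : ℝ) (i : ℕ) :
    ∑ n ∈ (C.newModulus P i).divisors, (lcmTupleCount k n : ℝ) * expOmegaDiv lam n =
      ∏ p ∈ primesIoc (P i) (P (i + 1)),
        (1 + Real.exp lam * ∑ j ∈ Finset.Icc 1 (padicValNat p C.totalModulus),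
          (((j : ℝ) + 1) ^ k - (j : ℝ) ^ k) / (p : ℝ) ^ j) := by
  rw [newModulus, sum_divisors_prod_prime_pow (fun p hp => (mem_primesIoc.mp hp).1) _
    (by rw [lcmTupleCount_one hk, expOmegaDiv_one, one_mul])]
  · refine Finset.prod_congr rfl fun p hp => ?_
    rw [Finset.mul_sum]
    congr 1
    refine Finset.sum_congr rfl fun j hj => ?_
    have hp' := (mem_primesIoc.mp hp).1
    have hj' := (Finset.mem_Icc.mp hj).1
    rw [lcmTupleCount_prime_pow k hp' hj', expOmegaDiv_prime_pow lam hp' hj']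
    ring
  · intro m n hm hn h
    rw [lcmTupleCount_mul hk hm hn h, expOmegaDiv_mul lam h]
    ring

/-- Term by term over m n: in the numerator the local lemma splits off e^(lam ω(n))/n and `T` is
enlarged to `X`; the denominator, the preserved mass of `T`, is at least `c` times that of `X`.
Multiplicativity of ℓ_k then factors the double sum. -/
theorem biasPow_next_le (h0 : 0 ≤ P i) (h1 : P i ≤ P (i + 1)) {w : ℤ → ℝ}
    (hw0 : ∀ r, 0 ≤ w r) (hw : ∀ r s : ℤ, r ≡ s [ZMOD C.Q P i] → w r = w s) {X T : Set ℤ}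
    (hT : DefinedMod (C.Q P i) T) (hTX : T ⊆ X) (hXR : X ⊆ C.R P i) {lam : ℝ} (hlam : 0 < lam)
    (hgood : ∀ r ∈ T, C.IsGood P i lam r) {c : ℝ} (hc : 0 < c) (hX : 0 < C.mass P i w X)
    (hmass : c ≤ C.mass P i w T / C.mass P i w X) {k : ℕ} (hk : 1 ≤ k) :
    C.biasPow P (i + 1) (C.nextWeight P i T w) (T ∩ C.R P (i + 1)) k ≤
      C.biasPow P i w X k / c * ∏ p ∈ primesIoc (P i) (P (i + 1)),
        (1 + Real.exp lam * ∑ j ∈ Finset.Icc 1 (padicValNat p C.totalModulus),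
          (((j : ℝ) + 1) ^ k - (j : ℝ) ^ k) / (p : ℝ) ^ j) := by
  have hTR := hTX.trans hXR
  have hcT : c * C.mass P i w X ≤ C.mass P i w T := (le_div_iff₀ hX).mp hmass
  have hT0 : 0 < C.mass P i w T := (mul_pos hc hX).trans_le hcT
  rw [← lcmTuple_expOmegaDiv_sum hk lam i, biasPow, Q_succ h0 h1,
    sum_divisors_mul_of_coprime coprime_newModulus_Q.symm, biasPow, Finset.sum_div,
    Finset.sum_mul_sum]
  refine Finset.sum_le_sum fun m hm => Finset.sum_le_sum fun n hn => ?_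
  have hm0 := Nat.pos_of_mem_divisors hm
  have hn0 := Nat.pos_of_mem_divisors hn
  have hmd := Nat.dvd_of_mem_divisors hm
  have hnd := Nat.dvd_of_mem_divisors hn
  rw [lcmTupleCount_mul hk hm0 hn0 ((coprime_newModulus_Q.of_dvd_left hnd).of_dvd_right hmd).symm]
  rw [show ∀ a b c d e : ℝ, a * b / c * (d * e) = a * d * (b / c * e) by intros; ring]
  refine mul_le_mul_of_nonneg_left ?_ (by positivity)
  have : Nonempty (Fin (m * n)) := ⟨⟨0, Nat.mul_pos hm0 hn0⟩⟩
  refine ciSup_le fun b => ?_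
  rw [mass_next_eq h0 h1 hw hT hTR hlam hgood]
  have hb := bias_term_le (C := C) (P := P) (i := i) (w := w) (X := X) hm0 ((b : ℕ) : ℤ)
  have he := expOmegaDiv_nonneg lam n
  have hmX := mass_nonneg (C := C) (P := P) (i := i) hw0 (X ∩ residueClass ((b : ℕ) : ℤ) m)
  calc _ ≤ expOmegaDiv lam n * C.mass P i w (X ∩ residueClass ((b : ℕ) : ℤ) m) /
        (c * C.mass P i w X) := by
        refine div_le_div₀ (mul_nonneg he hmX) ?_ (mul_pos hc hX) hcT
        refine (mass_next_residueClass_le h0 h1 hw0 hw hT hTR hlam hgood hmd hnd _).trans ?_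
        exact mul_le_mul_of_nonneg_left
          (mass_mono hw0 (Set.inter_subset_inter_left _ hTX)) he
    _ = C.mass P i w (X ∩ residueClass ((b : ℕ) : ℤ) m) / C.mass P i w X / c *
        expOmegaDiv lam n := by
        field_simp
    _ ≤ _ := by gcongr

/-! ### Moments of the goodness sum and the mass of bad fibres. -/

/-- `|A_{n,r} mod n Q_i|` is at most the number of `m₀ ∣ Q_i` with `r ≡ a_{m₀ n} [ZMOD m₀]`. -/
theorem residueCount_removed_le {n : ℕ} (hn : n ∣ C.newModulus P i) (r : ℤ)
    [∀ m, DecidablePred (· ∈ residueClass (C.residue (m * n)) m)] :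
    (residueCount (n * C.Q P i) (C.removed P i n r) : ℝ) ≤
      ∑ m ∈ (C.Q P i).divisors, if r ∈ residueClass (C.residue (m * n)) m then (1 : ℝ) else 0 := by
  classical
  have hn0 := Nat.pos_of_dvd_of_pos hn (C.newModulus_pos P i)
  rw [residueCount_removed hn0]
  -- The condition m n ∈ 𝓜_{i+1} is dropped; `residue` is defined at every natural number, so the
  -- extra classes only weaken the bound. Each class meets the fibre only if it is compatible with
  -- `r` modulo `m`, and then in at most one `t` modulo `n`, because Q_i is prime to `n`.
  have hcov : countMod n (C.fibreRemoved P i r n) ≤ ∑ m ∈ (C.Q P i).divisors,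
      countMod n {t : ℤ | r + C.Q P i * t ∈ residueClass (C.residue (m * n)) (m * n)} := by
    simp only [countMod_eq_card]
    refine le_trans (Finset.card_le_card fun t ht => ?_) Finset.card_biUnion_le
    obtain ⟨ht, -, m, hm, -, htm⟩ := Finset.mem_filter.mp ht
    exact Finset.mem_biUnion.mpr ⟨m, Nat.mem_divisors.mpr ⟨hm, (C.Q_pos P i).ne'⟩,
      Finset.mem_filter.mpr ⟨ht, htm⟩⟩
  refine (Nat.cast_le.mpr hcov).trans ?_
  rw [Nat.cast_sum]
  refine Finset.sum_le_sum fun m hm => ?_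
  split_ifs with hr
  · rw [← Nat.cast_one, Nat.cast_le]
    refine (countMod_mono fun t ht => ?_).trans
      (countMod_linear_le_one (coprime_newModulus_Q.of_dvd_left hn) r (C.residue (m * n)))
    exact Int.ModEq.of_dvd (Int.natCast_dvd_natCast.mpr (dvd_mul_left n m)) ht
  · refine Nat.cast_nonpos.mpr (Nat.le_zero.mp ((countMod_mono (Y := ∅) fun t ht =>
      hr ?_).trans_eq (by simp [countMod])))
    have h2 : r + C.Q P i * t ≡ C.residue (m * n) [ZMOD m] :=
      Int.ModEq.of_dvd (Int.natCast_dvd_natCast.mpr (dvd_mul_right m n)) ht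
    have h3 : r + C.Q P i * t ≡ r [ZMOD m] :=
      Int.ModEq.of_dvd (Int.natCast_dvd_natCast.mpr (Nat.dvd_of_mem_divisors hm))
        (add_mul_mem_residueClass _ _ _)
    exact h3.symm.trans h2

variable (C P) in
/-- The sum over `n ∈ 𝓝_{i+1}`, `p ∣ n`, that decides whether a fibre is good. -/
noncomputable def goodSum (i : ℕ) (lam : ℝ) (p : ℕ) (r : ℤ) : ℝ :=
  ∑ n ∈ C.newFactors P i with p ∣ n,
    (residueCount (n * C.Q P i) (C.removed P i n r) : ℝ)
      * Real.exp (lam * n.primeFactors.card) / n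

theorem goodSum_nonneg (lam : ℝ) (p : ℕ) (r : ℤ) : 0 ≤ C.goodSum P i lam p r :=
  Finset.sum_nonneg fun _ _ => by positivity

/-- Jensen with the weights e^(lam ω(n))/n moves the k-th power inside the sum over `n`. For each
fixed `n` the moment bound applies to the classes a_{mn} mod m and does not depend on `n`, so only
the total weight of the multiples of `p` remains, to the power `k`. -/
theorem moment_goodSum_le (h0 : 0 ≤ P i) (h1 : P i ≤ P (i + 1)) {w : ℤ → ℝ}
    (hw0 : ∀ r, 0 ≤ w r) {X : Set ℤ} [DecidablePred (· ∈ X)] (hX : 0 < C.mass P i w X)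
    (lam : ℝ) {k : ℕ} (hk : 1 ≤ k) {p : ℕ} (hp : p ∈ primesIoc (P i) (P (i + 1))) :
    ∑ r ∈ Finset.range (C.Q P i) with ((r : ℕ) : ℤ) ∈ X, w r * C.goodSum P i lam p r ^ k ≤
      (Real.exp lam / ((p : ℝ) - 1) *
        ∏ q ∈ primesIoc (P i) (P (i + 1)), (1 + Real.exp lam / ((q : ℝ) - 1))) ^ k *
        (C.mass P i w X * C.biasPow P i w X k) := by
  classical
  set I : Finset ℕ := {n ∈ C.newFactors P i | p ∣ n} with hI
  set x : ℕ → ℤ → ℝ := fun n r => ∑ m ∈ (C.Q P i).divisors,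
    if r ∈ residueClass (C.residue (m * n)) m then (1 : ℝ) else 0 with hx
  have hx0 : ∀ n r, 0 ≤ x n r := fun n r =>
    Finset.sum_nonneg fun m _ => by split_ifs <;> norm_num
  set c₀ := ∑ n ∈ I, expOmegaDiv lam n with hc₀
  have hc₀0 : 0 ≤ c₀ := Finset.sum_nonneg fun n _ => expOmegaDiv_nonneg lam n
  have hc₀le : c₀ ≤ Real.exp lam / ((p : ℝ) - 1) *
      ∏ q ∈ primesIoc (P i) (P (i + 1)), (1 + Real.exp lam / ((q : ℝ) - 1)) := by
    refine le_trans ?_ (sum_divisors_expOmegaDiv_of_dvd_le lam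
      (fun q hq => (mem_primesIoc.mp hq).1) (fun q => padicValNat q C.totalModulus) hp)
    refine Finset.sum_le_sum_of_subset_of_nonneg (fun n hn => ?_)
      fun _ _ _ => expOmegaDiv_nonneg _ _
    obtain ⟨hn, hpn⟩ := Finset.mem_filter.mp hn
    exact Finset.mem_filter.mpr ⟨Nat.mem_divisors.mpr
      ⟨((mem_newFactors h0 h1).mp hn).1, (C.newModulus_pos P i).ne'⟩, hpn⟩
  have hle : ∀ r : ℤ, C.goodSum P i lam p r ≤ ∑ n ∈ I, expOmegaDiv lam n * x n r := by
    intro r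
    refine Finset.sum_le_sum fun n hn => ?_
    have hnN := ((mem_newFactors h0 h1).mp (Finset.mem_filter.mp hn).1).1
    rw [mul_div_assoc, mul_comm]
    exact mul_le_mul_of_nonneg_left (residueCount_removed_le hnN r) (expOmegaDiv_nonneg lam n)
  have hB : 0 ≤ C.mass P i w X * C.biasPow P i w X k :=
    mul_nonneg hX.le (biasPow_nonneg hw0 X k)
  calc _ ≤ ∑ r ∈ Finset.range (C.Q P i) with ((r : ℕ) : ℤ) ∈ X,
        w r * (c₀ ^ (k - 1) * ∑ n ∈ I, expOmegaDiv lam n * x n r ^ k) := by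
        refine Finset.sum_le_sum fun r _ => mul_le_mul_of_nonneg_left ?_ (hw0 _)
        exact (pow_le_pow_left₀ (goodSum_nonneg _ _ _) (hle r) k).trans
          (sum_mul_pow_le I _ _ (fun n _ => expOmegaDiv_nonneg lam n) (fun n _ => hx0 n r) hk)
    _ = c₀ ^ (k - 1) * ∑ n ∈ I, expOmegaDiv lam n *
        ∑ r ∈ Finset.range (C.Q P i) with ((r : ℕ) : ℤ) ∈ X, w r * x n r ^ k := by
        simp only [Finset.mul_sum]
        rw [Finset.sum_comm]
        refine Finset.sum_congr rfl fun n _ => Finset.sum_congr rfl fun r _ => ?_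
        ring
    _ ≤ c₀ ^ (k - 1) * ∑ n ∈ I, expOmegaDiv lam n *
        (C.mass P i w X * C.biasPow P i w X k) := by
        refine mul_le_mul_of_nonneg_left (Finset.sum_le_sum fun n _ => ?_) (pow_nonneg hc₀0 _)
        exact mul_le_mul_of_nonneg_left
          (moment_classes_le hw0 hX (fun m => C.residue (m * n)) k) (expOmegaDiv_nonneg lam n)
    _ = c₀ ^ k * (C.mass P i w X * C.biasPow P i w X k) := by
        rw [← Finset.sum_mul, ← mul_assoc, ← pow_succ, Nat.sub_add_cancel hk]
    _ ≤ _ := mul_le_mul_of_nonneg_right (pow_le_pow_left₀ hc₀0 hc₀le k) hB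

/-- The Markov inequality for the total mass of the bad fibres. -/
theorem mass_bad_le (h0 : 0 ≤ P i) (h1 : P i ≤ P (i + 1)) {w : ℤ → ℝ}
    (hw0 : ∀ r, 0 ≤ w r) {X : Set ℤ} (hX : 0 < C.mass P i w X)
    {lam : ℝ} (hlam : 0 < lam) {c : ℝ} (hc : c < 1)
    (hC1 : C.ConstraintC1 P i w X lam c) :
    C.mass P i w (X ∩ {r | ¬ C.IsGood P i lam r}) ≤ (1 - c) * C.mass P i w X := by
  classical
  obtain ⟨k, hk, hC⟩ := hC1
  have hk0 : k ≠ 0 := by omega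
  set Pi := ∏ q ∈ primesIoc (P i) (P (i + 1)), (1 + Real.exp lam / ((q : ℝ) - 1)) with hPi
  set V := ∑ p ∈ primesIoc (P i) (P (i + 1)), 1 / ((p : ℝ) - 1) ^ k with hV
  have hp1 : ∀ p ∈ primesIoc (P i) (P (i + 1)), 0 < (p : ℝ) - 1 := fun p hp => by
    have : (2 : ℝ) ≤ p := by exact_mod_cast (mem_primesIoc.mp hp).1.two_le
    linarith
  have hV0 : 0 ≤ V := Finset.sum_nonneg fun p hp => by have := hp1 p hp; positivity
  have hPi0 : 0 ≤ Pi := Finset.prod_nonneg fun p hp => by have := hp1 p hp; positivity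
  have hβ0 : 0 ≤ C.bias P i w X k := Real.rpow_nonneg (biasPow_nonneg hw0 X k) _
  set d := 1 - Real.exp (-lam) with hd
  have hd0 : 0 < d := by
    have : Real.exp (-lam) < 1 := Real.exp_lt_one_iff.mpr (by linarith)
    linarith
  -- The k-th power of (C1) removes all roots: Π^k β_k^k V e^(k lam) ≤ d^k (1 - c), where d is the
  -- threshold of goodness.
  have hCk := pow_le_pow_left₀ (mul_nonneg hPi0 (mul_nonneg hβ0 (Real.rpow_nonneg hV0 _))) hC k
  rw [mul_pow, mul_pow, mul_pow, bias_pow hw0 X hk, one_div,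
    Real.rpow_inv_natCast_pow hV0 hk0, Real.rpow_inv_natCast_pow (by linarith) hk0, div_pow,
    div_mul_eq_mul_div, le_div_iff₀ (by positivity)] at hCk
  -- A bad fibre exceeds the threshold for at least one prime, so the sum over all primes dominates
  -- d^k there.
  have hmarkov : d ^ k * C.mass P i w (X ∩ {r | ¬ C.IsGood P i lam r}) ≤
      ∑ p ∈ primesIoc (P i) (P (i + 1)),
        ∑ r ∈ Finset.range (C.Q P i) with ((r : ℕ) : ℤ) ∈ X, w r * C.goodSum P i lam p r ^ k := by
    rw [Finset.sum_comm, mass_eq_sum, Finset.sum_filter, Finset.mul_sum]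
    refine Finset.sum_le_sum fun r _ => ?_
    have hterm : ∀ p ∈ primesIoc (P i) (P (i + 1)), 0 ≤ w r * C.goodSum P i lam p r ^ k :=
      fun p _ => mul_nonneg (hw0 _) (pow_nonneg (goodSum_nonneg _ _ _) _)
    by_cases hr : (r : ℤ) ∈ X ∩ {r | ¬ C.IsGood P i lam r}
    · rw [if_pos hr, if_pos hr.1]
      obtain ⟨p, hp, hpr⟩ : ∃ p ∈ primesIoc (P i) (P (i + 1)), d < C.goodSum P i lam p r := by
        have := hr.2
        simp only [Set.mem_ofPred_eq, IsGood, not_forall, not_le] at this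
        obtain ⟨p, hp, hpr⟩ := this
        exact ⟨p, hp, hpr⟩
      refine le_trans ?_ (Finset.single_le_sum hterm hp)
      rw [mul_comm]
      exact mul_le_mul_of_nonneg_left (pow_le_pow_left₀ hd0.le hpr.le k) (hw0 _)
    · rw [if_neg hr, mul_zero]
      split_ifs
      exacts [Finset.sum_nonneg hterm, le_rfl]
  have hsum := hmarkov.trans (Finset.sum_le_sum fun p hp =>
    moment_goodSum_le h0 h1 hw0 hX lam hk hp)
  have heq : ∑ p ∈ primesIoc (P i) (P (i + 1)), (Real.exp lam / ((p : ℝ) - 1) * Pi) ^ k *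
      (C.mass P i w X * C.biasPow P i w X k) =
      C.mass P i w X * (Pi ^ k * (C.biasPow P i w X k * V) * Real.exp lam ^ k) := by
    rw [← Finset.sum_mul, hV]
    simp only [mul_pow, div_pow]
    rw [← Finset.sum_mul]
    simp only [div_eq_mul_one_div (Real.exp lam ^ k)]
    rw [← Finset.mul_sum]
    ring
  rw [heq] at hsum
  have hfin := hsum.trans (mul_le_mul_of_nonneg_left hCk hX.le)
  refine le_of_mul_le_mul_left (hfin.trans_eq ?_) (pow_pos hd0 k)
  ring

end CongruenceSystem

/-! ### The theorem, with R_i^* the set of all good fibres. -/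

theorem theorem2 (C : CongruenceSystem) (P : ℕ → ℝ) (hP0 : 2 ≤ P 0) (hP : StrictMono P)
    (i : ℕ)
    -- the previously chosen sets, `S j = R_{j-1}^*` for `0 ≤ j ≤ i`
    (S : ℕ → Set ℤ) (hS0 : S 0 = Set.univ)
    (hS : ∀ j < i, S (j + 1) ⊆ S j ∩ C.R P j ∧ DefinedMod (C.Q P j) (S (j + 1)))
    (hne : (S i ∩ C.R P i).Nonempty)
    (pigood : ℝ) (hpi0 : 0 < pigood) (hpi1 : pigood < 1) (lam : ℝ) (hlam : 0 < lam)
    (hC1 : C.ConstraintC1 P i (C.weight P S i) (S i ∩ C.R P i) lam pigood) :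
    -- `T = R_i^*`, the set of good fibres
    ∃ T : Set ℤ, T ⊆ S i ∩ C.R P i ∧ DefinedMod (C.Q P i) T ∧
      (∀ r ∈ S i ∩ C.R P i, r ∈ T ↔ C.IsGood P i lam r) ∧
      pigood ≤ C.mass P i (C.weight P S i) T /
        C.mass P i (C.weight P S i) (S i ∩ C.R P i) ∧
      (∀ r ∈ T, 0 < C.fibreDensity P i r) ∧
      ∀ k : ℕ, 1 ≤ k →
        C.biasPow P (i + 1) (C.nextWeight P i T (C.weight P S i)) (T ∩ C.R P (i + 1)) k ≤
          C.biasPow P i (C.weight P S i) (S i ∩ C.R P i) k / pigood *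
            ∏ p ∈ primesIoc (P i) (P (i + 1)),
              (1 + Real.exp lam * ∑ j ∈ Finset.Icc 1 (padicValNat p C.totalModulus),
                (((j : ℝ) + 1) ^ k - (j : ℝ) ^ k) / (p : ℝ) ^ j) := by
  have hP00 : 0 ≤ P 0 := zero_le_two.trans hP0
  have h0 : 0 ≤ P i := hP00.trans (hP.monotone (Nat.zero_le i))
  have h1 : P i ≤ P (i + 1) := hP.monotone (Nat.le_succ i)
  set w := C.weight P S i with hw
  set X := S i ∩ C.R P i with hX
  have hw0 : ∀ r, 0 ≤ w r := CongruenceSystem.weight_nonneg i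
  have hwc : ∀ r s : ℤ, r ≡ s [ZMOD C.Q P i] → w r = w s := fun r s h =>
    CongruenceSystem.weight_congr hP hP00 hS h
  have hXd : DefinedMod (C.Q P i) X :=
    (CongruenceSystem.definedMod_stage_set hP hP00 hS0 hS).inter
      (CongruenceSystem.definedMod_R i)
  have hXm : 0 < C.mass P i w X :=
    CongruenceSystem.mass_pos hw0 hXd (fun r hr => CongruenceSystem.weight_pos hS hr) hne
  set T := X ∩ {r | C.IsGood P i lam r} with hT
  have hTd : DefinedMod (C.Q P i) T :=
    hXd.inter fun r s h => CongruenceSystem.isGood_congr h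
  have hTX : T ⊆ X := Set.inter_subset_left
  have hTgood : ∀ r ∈ T, C.IsGood P i lam r := fun r hr => hr.2
  have hmass : pigood ≤ C.mass P i w T / C.mass P i w X := by
    classical
    rw [le_div_iff₀ hXm]
    have hbad := CongruenceSystem.mass_bad_le h0 h1 hw0 hXm hlam hpi1 hC1
    have hsplit : C.mass P i w X =
        C.mass P i w T + C.mass P i w (X ∩ {r | ¬ C.IsGood P i lam r}) := by
      rw [CongruenceSystem.mass_eq_sum, CongruenceSystem.mass_eq_sum,
        CongruenceSystem.mass_eq_sum, ← Finset.sum_add_distrib]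
      refine Finset.sum_congr rfl fun r _ => ?_
      by_cases hr : (r : ℤ) ∈ X <;> by_cases hg : C.IsGood P i lam r <;> simp [hT, hr, hg]
    linarith
  refine ⟨T, hTX, hTd, fun r hr => ⟨fun h => h.2, fun h => ⟨hr, h⟩⟩, hmass, fun r hr => ?_,
    fun k hk => CongruenceSystem.biasPow_next_le h0 h1 hw0 hwc hTd hTX Set.inter_subset_right
      hlam hTgood hpi0 hXm hmass hk⟩
  refine div_pos (Nat.cast_pos.mpr ?_) (Nat.cast_pos.mpr ?_)
  · exact CongruenceSystem.residueCount_fibrePart_pos h0 h1 (hTX hr).2 hlam (hTgood r hr)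
  · exact residueCount_pos (C.Q_pos P (i + 1)) ⟨r, Int.ModEq.refl r⟩
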